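/- A \emph{virtual link diagram} is an oriented link diagram in the plane (a generic immersion of finitely many oriented circles), considered up to planar isotopy, each of whose double points is either a classical crossing (positive or negative, with over/under information) or a virtual crossing. Two virtual link diagrams are \emph{equivalent as welded links} if they are related by a finite sequence of planar isotopies, Reidemeister moves I, II, III, virtual Reidemeister moves I, II, III (the same moves with all crossings virtual), virtual move IV (a strand with two virtual crossings passes a classical crossing), and welded moves (a strand that is the over strand at two classical crossings passes a virtual crossing), in all orientations. A \emph{welded link} is an equivalence class of virtual link diagrams under this relation. For a virtual link diagram $D$, the diagram $\phi_+(D)$ is obtained by replacing every strand of $D$ by two parallel strands: the main one $R$, on the right with respect to the orientation of $D$, and the secondary one $L$, on the left, both oriented like $D$. Each crossing of $D$ thus becomes four crossings. If the crossing of $D$ is virtual, all four are virtual. If it is classical, with over strand $o$ and under strand $u$, then the copy $R_o$ passes over $R_u$ and over $L_u$ in classical crossings, and the crossings of $L_o$ with $R_u$ and with $L_u$ are virtual. Moreover, near each classical crossing a twist, consisting of two crossings of $R_u$ and $L_u$ with each other, is inserted into the pair of copies of the under strand: * if the crossing of $D$ is positive, the twist is placed after the crossing with respect to the orientation of $u$,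 and along this orientation one meets first a classical crossing at which $R_u$ passes over $L_u$ and whose sign is $-1$, and then a virtual crossing; * if the crossing of $D$ is negative, the twist is placed before the crossing with respect to the orientation of $u$, and along this orientation one meets first a virtual crossing and then a classical crossing at which $R_u$ passes over $L_u$ and whose sign is $+1$. The diagram $\phi_-(D)$ is obtained from $\phi_+(D)$ by reversing the orientation of all secondary strands. **Theorem.** If two virtual link diagrams $D$ and $D'$ are equivalent as welded links, then $\phi_+(D)$ and $\phi_+(D')$ are equivalent as welded links, and so are $\phi_-(D)$ and $\phi_-(D')$. Hence there are unique maps $\phi_+$ and $\phi_-$ from the set of welded links to itself that send the class of $D$ to the class of $\phi_+(D)$ and to the class of $\phi_-(D)$, respectively, for every virtual link diagram $D$. -/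

import Mathlib

/-! Oriented virtual link diagrams in the plane, cut into horizontal layers.  A diagram in general
position with respect to the height function is read from bottom to top; at every regular level it
meets the level in finitely many points, recorded from left to right by the direction (upward or
downward) in which the strand through the point is oriented. -/

namespace WeldedLinks

/-- The vertical direction of an oriented strand at a regular level. -/
inductive Dir where
  | up
  | down
  deriving DecidableEq

/-- The opposite direction. -/
def Dir.rev : Dir → Dir
  | .up => .down
  | .down => .up

/-- The kind of a crossing.  `over` (`under`) is a classical crossing in which the strand joining
the bottom left end to the top right end is the over strand (the under strand); `virt` is a virtual
crossing. -/
inductive Kind where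
  | over
  | under
  | virt
  deriving DecidableEq

/-- The kind of the same crossing with the names of its two strands exchanged. -/
def Kind.flip : Kind → Kind
  | .over => .under
  | .under => .over
  | .virt => .virt

/-- The elementary pieces of a diagram: local minima, local maxima, crossings.
`cup s` is a minimum whose left leg has direction `s`, `cap s` is a maximum whose left leg has
direction `s`, and `cross k s t` is a crossing of kind `k` of a strand of direction `s` going from
bottom left to top right and a strand of direction `t` going from bottom right to top left. -/
inductive Piece where
  | cup (s : Dir)
  | cap (s : Dir)
  | cross (k : Kind) (s t : Dir)
  deriving DecidableEq

/-- The directions at the bottom of a piece, from left to right. -/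
def Piece.bot : Piece → List Dir
  | .cup _ => []
  | .cap s => [s, s.rev]
  | .cross _ s t => [s, t]

/-- The directions at the top of a piece, from left to right. -/
def Piece.top : Piece → List Dir
  | .cup s => [s, s.rev]
  | .cap _ => []
  | .cross _ s t => [t, s]

/-- A layer: one elementary piece with `pos` vertical strands to the left of it (and any number of
vertical strands to the right). -/
structure Layer where
  pos : ℕ
  piece : Piece
  deriving DecidableEq

/-- The layer `x` fits between a level with directions `a` (below) and one with directions `b`. -/
def Layer.Fits (x : Layer) (a b : List Dir) : Prop :=
  ∃ l r : List Dir, l.length = x.pos ∧ a = l ++ x.piece.bot ++ r ∧ b = l ++ x.piece.top ++ r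

/-- The layers of the list `w`, stacked from bottom to top, form a tangle diagram from the level `a`
to the level `b`. -/
def Fits : List Layer → List Dir → List Dir → Prop
  | [], a, b => a = b
  | x :: w, a, b => ∃ c, x.Fits a c ∧ Fits w c b

/-- An oriented virtual link diagram in the plane. -/
structure Diagram where
  word : List Layer
  closed : Fits word [] []

/-! ### Moves -/

/-- The triangles through which a strand may be pushed.  For three strands `1`, `2`, `3` numbered
from left to right at the bottom, `k₁₂`, `k₁₃`, `k₂₃` are the kinds of their crossings, where the
first index is always the strand going from bottom left to top right. -/
inductive Triangle : Kind → Kind → Kind → Prop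
  /-- Reidemeister move III: three classical crossings, no strand order being cyclic. -/
  | classical (k₁₂ k₁₃ k₂₃ : Kind) (h₁₂ : k₁₂ ≠ .virt) (h₁₃ : k₁₃ ≠ .virt) (h₂₃ : k₂₃ ≠ .virt)
      (acyclic : ¬ (k₁₂ = k₂₃ ∧ k₁₃ = k₁₂.flip)) : Triangle k₁₂ k₁₃ k₂₃
  /-- Virtual move III: three virtual crossings. -/
  | virtual : Triangle .virt .virt .virt
  /-- Virtual move IV: one strand has two virtual crossings, the third crossing is classical. -/
  | mixed₁ (k : Kind) (h : k ≠ .virt) : Triangle .virt .virt k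
  | mixed₂ (k : Kind) (h : k ≠ .virt) : Triangle .virt k .virt
  | mixed₃ (k : Kind) (h : k ≠ .virt) : Triangle k .virt .virt
  /-- Welded move: one strand is over at two classical crossings, the third crossing is virtual. -/
  | welded₁ : Triangle .over .over .virt
  | welded₂ : Triangle .under .virt .over
  | welded₃ : Triangle .virt .under .under

/-- The local moves.  Each relates two stacks of layers with the same bottom and top levels. -/
inductive Move : List Layer → List Layer → Prop
  /-- Planar isotopy: two pieces beside each other, with `n` strands between them, exchange heights. -/
  | exchange (i n : ℕ) (p q : Piece) :
      Move [⟨i, p⟩, ⟨i + p.top.length + n, q⟩] [⟨i + p.bot.length + n, q⟩, ⟨i, p⟩]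
  /-- Planar isotopy: a minimum and an adjacent maximum cancel. -/
  | zigzagRight (i : ℕ) (s : Dir) : Move [⟨i + 1, .cup s.rev⟩, ⟨i, .cap s⟩] []
  | zigzagLeft (i : ℕ) (s : Dir) : Move [⟨i, .cup s⟩, ⟨i + 1, .cap s.rev⟩] []
  /-- Planar isotopy: a crossing slides over a maximum, or under a minimum, of one of its strands. -/
  | slideCap (i : ℕ) (k : Kind) (s t : Dir) :
      Move [⟨i, .cross k s t⟩, ⟨i + 1, .cap s⟩] [⟨i + 1, .cross k.flip t s.rev⟩, ⟨i, .cap s⟩]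
  | slideCup (i : ℕ) (k : Kind) (s t : Dir) :
      Move [⟨i + 1, .cup s⟩, ⟨i, .cross k t s⟩] [⟨i, .cup s⟩, ⟨i + 1, .cross k.flip s.rev t⟩]
  /-- Reidemeister move I (classical `k`) and virtual move I (`k = virt`): a curl disappears. -/
  | curlRight (i : ℕ) (k : Kind) (s : Dir) :
      Move [⟨i + 1, .cup s⟩, ⟨i, .cross k s s⟩, ⟨i + 1, .cap s⟩] []
  | curlLeft (i : ℕ) (k : Kind) (s : Dir) :
      Move [⟨i, .cup s.rev⟩, ⟨i + 1, .cross k s s⟩, ⟨i, .cap s.rev⟩] []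
  /-- Reidemeister move II (classical `k`) and virtual move II (`k = virt`). -/
  | bigon (i : ℕ) (k : Kind) (s t : Dir) : Move [⟨i, .cross k s t⟩, ⟨i, .cross k.flip t s⟩] []
  /-- Reidemeister move III, virtual moves III and IV, and the welded move. -/
  | triangle (i : ℕ) (k₁₂ k₁₃ k₂₃ : Kind) (h : Triangle k₁₂ k₁₃ k₂₃) (s t u : Dir) :
      Move [⟨i, .cross k₁₂ s t⟩, ⟨i + 1, .cross k₁₃ s u⟩, ⟨i, .cross k₂₃ t u⟩]
        [⟨i + 1, .cross k₂₃ t u⟩, ⟨i, .cross k₁₃ s u⟩, ⟨i + 1, .cross k₁₂ s t⟩]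

/-- `D'` arises from `D` by replacing some consecutive layers according to one local move. -/
def Diagram.Step (D D' : Diagram) : Prop :=
  ∃ u x y v : List Layer, Move x y ∧ D.word = u ++ x ++ v ∧ D'.word = u ++ y ++ v

/-- Equivalence as welded links: the equivalence relation generated by planar isotopy, the
Reidemeister moves, the virtual Reidemeister moves and the welded move. -/
def WeldedEquiv : Diagram → Diagram → Prop :=
  Relation.EqvGen Diagram.Step

/-- Welded equivalence as a setoid. -/
def weldedSetoid : Setoid Diagram := Relation.EqvGen.setoid Diagram.Step

/-- A welded link is a welded equivalence class of virtual link diagrams. -/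
def WeldedLink : Type := Quotient weldedSetoid

/-- The welded link represented by a diagram. -/
def Diagram.toWeldedLink (D : Diagram) : WeldedLink := Quotient.mk weldedSetoid D

/-! ### The parallel diagrams

Each strand is replaced by two parallel strands: the main one, to the right with respect to the
orientation of the strand and oriented like it, and the secondary one, to the left. -/

/-- The secondary strands are oriented like the original strands, or oppositely. -/
inductive Sense where
  | parallel
  | antiparallel
  deriving DecidableEq

/-- The direction of the secondary strand along a strand of direction `s`. -/
def Sense.secondary : Sense → Dir → Dir
  | .parallel, s => s
  | .antiparallel, s => s.rev

/-- The two copies of a strand are named after their position in the plane: for an upward strand the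
copy on the left of the page is the secondary one, for a downward strand it is the main one. -/
def leftIsMain : Dir → Bool
  | .up => false
  | .down => true

/-- Whether the copy on the right of the page is the main one. -/
def rightIsMain : Dir → Bool
  | .up => true
  | .down => false

/-- The direction of the copy on the left of the page. -/
def Sense.left (o : Sense) (s : Dir) : Dir := if leftIsMain s then s else o.secondary s

/-- The direction of the copy on the right of the page. -/
def Sense.right (o : Sense) (s : Dir) : Dir := if rightIsMain s then s else o.secondary s

/-- The kind of the crossing of a copy of the strand going from bottom left to top right (main if
`a`) with a copy of the other strand (main if `b`), at a crossing of kind `k`: it is classical, like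
the original one, if the original one is and if the copy of the over strand is the main one;
otherwise it is virtual. -/
def copyKind : Kind → Bool → Bool → Kind
  | .over, a, _ => if a then .over else .virt
  | .under, _, b => if b then .under else .virt
  | .virt, _, _ => .virt

/-- The four crossings of the copies of the two strands of a crossing with `i` strands to its left. -/
def grid (o : Sense) (i : ℕ) (k : Kind) (s t : Dir) : List Layer :=
  [⟨2 * i + 1, .cross (copyKind k (rightIsMain s) (leftIsMain t)) (o.right s) (o.left t)⟩,
   ⟨2 * i, .cross (copyKind k (leftIsMain s) (leftIsMain t)) (o.left s) (o.left t)⟩,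
   ⟨2 * i + 2, .cross (copyKind k (rightIsMain s) (rightIsMain t)) (o.right s) (o.right t)⟩,
   ⟨2 * i + 1, .cross (copyKind k (leftIsMain s) (rightIsMain t)) (o.left s) (o.right t)⟩]

/-- Whether a classical crossing is positive. -/
def isPositive (k : Kind) (s t : Dir) : Bool := (k == .over) == (s == t)

/-- Two consecutive crossings, of kinds `k` and `k'`, of the two copies of a strand of
direction `s`. -/
def twoCrossings (o : Sense) (j : ℕ) (s : Dir) (k k' : Kind) : List Layer :=
  [⟨j, .cross k (o.left s) (o.right s)⟩, ⟨j, .cross k' (o.right s) (o.left s)⟩]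

/-- The twist inserted on the two copies of the under strand, of direction `s`.  For a positive
crossing (`pos = true`) one meets, along the orientation of the strand, first a classical crossing
and then a virtual one (a `-1v`-twist), for a negative crossing first a virtual crossing and then a
classical one (a `v1`-twist).  At the classical crossing the main copy is over; if both copies
are given the orientation of the strand, its sign is `-1` in the first case and `1` in the second. -/
def twist (o : Sense) (j : ℕ) (pos : Bool) (s : Dir) : List Layer :=
  match pos, s with
  | true, .up => twoCrossings o j s .under .virt
  | true, .down => twoCrossings o j s .virt .under
  | false, .up => twoCrossings o j s .virt .over
  | false, .down => twoCrossings o j s .over .virt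

/-- The tangle replacing a crossing.  The twist lies on the under strand, behind the crossing (with
respect to the orientation of the under strand) if the crossing is positive and in front of it if
the crossing is negative; so it is above the crossing on the page exactly if the crossing is
positive and the under strand is directed upward, or neither. -/
def doubleCross (o : Sense) (i : ℕ) (k : Kind) (s t : Dir) : List Layer :=
  match k with
  | .virt => grid o i .virt s t
  | .over =>
    if isPositive .over s t == (t == .up) then
      grid o i .over s t ++ twist o (2 * i) (isPositive .over s t) t
    else
      twist o (2 * i + 2) (isPositive .over s t) t ++ grid o i .over s t
  | .under =>
    if isPositive .under s t == (s == .up) then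
      grid o i .under s t ++ twist o (2 * i + 2) (isPositive .under s t) s
    else
      twist o (2 * i) (isPositive .under s t) s ++ grid o i .under s t

/-- The layers replacing one layer. -/
def doubleLayer (o : Sense) (x : Layer) : List Layer :=
  match x.piece with
  | .cup s => [⟨2 * x.pos, .cup (o.left s)⟩, ⟨2 * x.pos + 1, .cup (o.right s)⟩]
  | .cap s => [⟨2 * x.pos + 1, .cap (o.right s)⟩, ⟨2 * x.pos, .cap (o.left s)⟩]
  | .cross k s t => doubleCross o x.pos k s t

/-- The two copies of every strand at a level. -/
def doubleLevel (o : Sense) (a : List Dir) : List Dir := a.flatMap fun s => [o.left s, o.right s]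

theorem fits_append {u v : List Layer} {a b c : List Dir} (hu : Fits u a b) (hv : Fits v b c) :
    Fits (u ++ v) a c := by
  induction u generalizing a with
  | nil => cases hu; exact hv
  | cons x u ih =>
    obtain ⟨d, hx, hd⟩ := hu
    exact ⟨d, hx, ih hd⟩

theorem fits_cons {x : Layer} {w : List Layer} {a b : List Dir} (l r : List Dir)
    (hl : l.length = x.pos) (ha : a = l ++ x.piece.bot ++ r)
    (hw : Fits w (l ++ x.piece.top ++ r) b) : Fits (x :: w) a b :=
  ⟨_, ⟨l, r, hl, ha, rfl⟩, hw⟩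

theorem left_rev (o : Sense) (s : Dir) : o.left s.rev = (o.right s).rev := by
  cases o <;> cases s <;> rfl

theorem right_rev (o : Sense) (s : Dir) : o.right s.rev = (o.left s).rev := by
  cases o <;> cases s <;> rfl

theorem doubleLevel_append (o : Sense) (a b : List Dir) :
    doubleLevel o (a ++ b) = doubleLevel o a ++ doubleLevel o b := by
  simp [doubleLevel]

theorem length_doubleLevel (o : Sense) (a : List Dir) :
    (doubleLevel o a).length = 2 * a.length := by
  induction a with
  | nil => rfl
  | cons s a ih =>
    rw [show s :: a = [s] ++ a from rfl, doubleLevel_append, List.length_append, ih]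
    simp [doubleLevel]; omega

theorem fits_grid (o : Sense) (k : Kind) (s t : Dir) (l r : List Dir) (i : ℕ)
    (hl : l.length = 2 * i) :
    Fits (grid o i k s t) (l ++ [o.left s, o.right s, o.left t, o.right t] ++ r)
      (l ++ [o.left t, o.right t, o.left s, o.right s] ++ r) := by
  refine fits_cons (l ++ [o.left s]) (o.right t :: r) (by simp [hl]) (by simp [Piece.bot]) ?_
  refine fits_cons l (o.right s :: o.right t :: r) (by simp [hl])
    (by simp [Piece.bot, Piece.top]) ?_
  refine fits_cons (l ++ [o.left t, o.left s]) r (by simp [hl])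
    (by simp [Piece.bot, Piece.top]) ?_
  refine fits_cons (l ++ [o.left t]) (o.right s :: r) (by simp [hl])
    (by simp [Piece.bot, Piece.top]) ?_
  simp [Fits, Piece.top]

theorem fits_twist (o : Sense) (pos : Bool) (s : Dir) (l r : List Dir) (j : ℕ)
    (hl : l.length = j) :
    Fits (twist o j pos s) (l ++ [o.left s, o.right s] ++ r)
      (l ++ [o.left s, o.right s] ++ r) := by
  have h : ∀ k k' : Kind, Fits (twoCrossings o j s k k') (l ++ [o.left s, o.right s] ++ r)
      (l ++ [o.left s, o.right s] ++ r) := fun k k' =>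
    fits_cons l r hl rfl (fits_cons l r hl rfl rfl)
  cases pos <;> cases s <;> exact h _ _

theorem fits_doubleCross (o : Sense) (k : Kind) (s t : Dir) (l r : List Dir) (i : ℕ)
    (hl : l.length = 2 * i) :
    Fits (doubleCross o i k s t) (l ++ [o.left s, o.right s, o.left t, o.right t] ++ r)
      (l ++ [o.left t, o.right t, o.left s, o.right s] ++ r) := by
  have hg := fun k => fits_grid o k s t l r i hl
  have h₀ : ∀ (p : Bool) (a b c : Dir), Fits (twist o (2 * i) p a)
      (l ++ [o.left a, o.right a, b, c] ++ r) (l ++ [o.left a, o.right a, b, c] ++ r) := by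
    intro p a b c
    simpa using fits_twist o p a l (b :: c :: r) (2 * i) hl
  have h₂ : ∀ (p : Bool) (a b c : Dir), Fits (twist o (2 * i + 2) p a)
      (l ++ [b, c, o.left a, o.right a] ++ r) (l ++ [b, c, o.left a, o.right a] ++ r) := by
    intro p a b c
    simpa using fits_twist o p a (l ++ [b, c]) r (2 * i + 2) (by simp [hl])
  unfold doubleCross
  cases k
  · dsimp only
    split_ifs
    · exact fits_append (hg _) (h₀ _ _ _ _)
    · exact fits_append (h₂ _ _ _ _) (hg _)
  · dsimp only
    split_ifs
    · exact fits_append (hg _) (h₂ _ _ _ _)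
    · exact fits_append (h₀ _ _ _ _) (hg _)
  · exact hg _

theorem fits_doubleLayer (o : Sense) {x : Layer} {a b : List Dir} (h : x.Fits a b) :
    Fits (doubleLayer o x) (doubleLevel o a) (doubleLevel o b) := by
  obtain ⟨i, p⟩ := x
  obtain ⟨l, r, hl, rfl, rfl⟩ := h
  have hl' : (doubleLevel o l).length = 2 * i := by rw [length_doubleLevel, hl]
  simp only [doubleLevel_append]
  generalize doubleLevel o l = L at hl'
  generalize doubleLevel o r = R
  cases p with
  | cup s =>
    refine fits_cons L R hl' (by simp [Piece.bot, doubleLevel]) ?_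
    refine fits_cons (L ++ [o.left s]) ((o.left s).rev :: R) (by simp [hl'])
      (by simp [Piece.bot, Piece.top]) ?_
    simp [Fits, Piece.top, doubleLevel, left_rev, right_rev]
  | cap s =>
    refine fits_cons (L ++ [o.left s]) ((o.left s).rev :: R) (by simp [hl'])
      (by simp [Piece.bot, doubleLevel, left_rev, right_rev]) ?_
    refine fits_cons L R hl' (by simp [Piece.bot, Piece.top]) ?_
    simp [Fits, Piece.top, doubleLevel]
  | cross k s t => exact fits_doubleCross o k s t L R i hl'

theorem fits_double (o : Sense) {w : List Layer} {a b : List Dir} (h : Fits w a b) :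
    Fits (w.flatMap (doubleLayer o)) (doubleLevel o a) (doubleLevel o b) := by
  induction w generalizing a with
  | nil => cases h; rfl
  | cons x w ih =>
    obtain ⟨c, hx, hw⟩ := h
    exact fits_append (fits_doubleLayer o hx) (ih hw)

/-- The diagram obtained by doubling all strands. -/
def Diagram.double (o : Sense) (D : Diagram) : Diagram where
  word := D.word.flatMap (doubleLayer o)
  closed := fits_double o D.closed

/-- The parallel diagram whose secondary strands are oriented like the original ones. -/
def phiPlus : Diagram → Diagram := Diagram.double .parallel

/-- The parallel diagram whose secondary strands are oriented oppositely. -/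
def phiMinus : Diagram → Diagram := Diagram.double .antiparallel

end WeldedLinks

/-!
Doubling respects every local move; the two orientations of the secondary strands need no separate
treatment, because only minima and maxima constrain directions.  The argument takes place in a
partially ordered monoid `TangleClass` of words of layers, in which `x ≤ y` says that the word `x` may
be replaced by `y` in every closed diagram.  It then suffices to show `double x ≤ double y` for every
move from `x` to `y` (`TangleClass.mk_flatMap_le`), since the doubles of two closed diagrams are
closed.

The doubled crossing is a grid of four crossings together with a twist on the under strand.  Any
triangle move that is allowed for three strands is also allowed for all copies of them
(`Triangle.copy`), hence grids satisfy all triangle moves (`TangleClass.grid_triangle`).  The same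
kind of check (`triangle_copies_left`, `triangle_copies_right`) shows that a twist on the copies of
one strand passes through the grid of that strand with any other one, over or under; here the welded
move is essential.  So a twist may be placed on either side of its crossing
(`TangleClass.mk_doubleCross`, `TangleClass.mk_doubleCross'`).  Since twists commute, and those of
opposite sign are inverse to each other, this gives the doubled triangle moves and bigons; twists
also slide around doubled minima and maxima, which gives the doubled slides.  In a doubled curl the
grid reduces to two crossings of the two copies of the strand with each other
(`TangleClass.doubleCup_grid_doubleCap_right_le` and its mirror image), and the twist is exactly what
cancels them.
-/

namespace WeldedLinks

/-! ### Words of layers up to replacement in closed diagrams -/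

theorem fits_append_iff {u v : List Layer} {a c : List Dir} :
    Fits (u ++ v) a c ↔ ∃ b, Fits u a b ∧ Fits v b c := by
  refine ⟨fun h => ?_, fun ⟨b, hu, hv⟩ => fits_append hu hv⟩
  induction u generalizing a with
  | nil => exact ⟨a, rfl, h⟩
  | cons x u ih =>
    obtain ⟨d, hx, hd⟩ := h
    obtain ⟨b, hu, hv⟩ := ih hd
    exact ⟨b, ⟨d, hx, hu⟩, hv⟩

/-- In every closed diagram that contains the consecutive layers `x`, these may be replaced by `y`:
the result is again a closed diagram, and it represents the same welded link. -/
def Simplifies (x y : List Layer) : Prop :=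
  ∀ (u v : List Layer) (h : Fits (u ++ x ++ v) [] []),
    ∃ h' : Fits (u ++ y ++ v) [] [], WeldedEquiv ⟨u ++ x ++ v, h⟩ ⟨u ++ y ++ v, h'⟩

theorem Simplifies.refl (x : List Layer) : Simplifies x x :=
  fun _ _ h => ⟨h, .refl _⟩

theorem Simplifies.trans {x y z : List Layer} (h₁ : Simplifies x y) (h₂ : Simplifies y z) :
    Simplifies x z := fun u v h =>
  let ⟨h', e⟩ := h₁ u v h
  let ⟨h'', e'⟩ := h₂ u v h'
  ⟨h'', .trans _ _ _ e e'⟩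

theorem Simplifies.append {x x' y y' : List Layer} (h₁ : Simplifies x x') (h₂ : Simplifies y y') :
    Simplifies (x ++ y) (x' ++ y') := by
  have h₁' : Simplifies (x ++ y) (x' ++ y) := fun u v h => by
    simpa using h₁ u (y ++ v) (by simpa using h)
  have h₂' : Simplifies (x' ++ y) (x' ++ y') := fun u v h => by
    simpa using h₂ (u ++ x') v (by simpa using h)
  exact h₁'.trans h₂'

theorem Simplifies.of_move {x y : List Layer} (hm : Move x y)
    (hf : ∀ a b, Fits x a b → Fits y a b) : Simplifies x y := by
  intro u v h
  obtain ⟨b, h₁, hv⟩ := fits_append_iff.1 h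
  obtain ⟨a, hu, hx⟩ := fits_append_iff.1 h₁
  exact ⟨fits_append (fits_append hu (hf _ _ hx)) hv, .rel _ _ ⟨u, x, y, v, hm, rfl, rfl⟩⟩

theorem Simplifies.of_move_symm {x y : List Layer} (hm : Move x y)
    (hf : ∀ a b, Fits y a b → Fits x a b) : Simplifies y x := by
  intro u v h
  obtain ⟨b, h₁, hv⟩ := fits_append_iff.1 h
  obtain ⟨a, hu, hx⟩ := fits_append_iff.1 h₁
  exact ⟨fits_append (fits_append hu (hf _ _ hx)) hv,
    .symm _ _ (.rel _ _ ⟨u, x, y, v, hm, rfl, rfl⟩)⟩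

/-- Two words that simplify to the same word simplify to each other as soon as they fit between the
same levels. -/
theorem Simplifies.of_common {x y z : List Layer} (hx : Simplifies x z) (hy : Simplifies y z)
    (hf : ∀ a b, Fits x a b → Fits y a b) : Simplifies x y := by
  intro u v h
  obtain ⟨b, h₁, hv⟩ := fits_append_iff.1 h
  obtain ⟨a, hu, hx'⟩ := fits_append_iff.1 h₁
  have h' := fits_append (fits_append hu (hf _ _ hx')) hv
  obtain ⟨h₃, e⟩ := hx u v h
  obtain ⟨_, e'⟩ := hy u v h'
  exact ⟨h', .trans _ _ _ e (.symm _ _ e')⟩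

/-- Two words are identified if each may replace the other in every closed diagram. -/
def tangleSetoid : Setoid (List Layer) where
  r x y := Simplifies x y ∧ Simplifies y x
  iseqv :=
    { refl := fun x => ⟨.refl x, .refl x⟩
      symm := fun h => ⟨h.2, h.1⟩
      trans := fun h h' => ⟨h.1.trans h'.1, h'.2.trans h.2⟩ }

/-- Words of layers up to mutual replacement in closed diagrams.  They form a monoid under stacking,
partially ordered by `Simplifies`: the inequality `x ≤ y` says that `x` may be replaced by `y`.  The
order takes care of the levels, which the words do not record: the moves that preserve the levels
between which a word fits become equations, whereas a bigon, a curl or a zigzag only satisfies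
`x ≤ 1`, because the empty word fits in more places. -/
def TangleClass : Type := Quotient tangleSetoid

namespace TangleClass

/-- The class of a word. -/
def mk (w : List Layer) : TangleClass := Quotient.mk tangleSetoid w

instance : Monoid TangleClass where
  mul := Quotient.map₂ (· ++ ·) fun _ _ h _ _ h' => ⟨h.1.append h'.1, h.2.append h'.2⟩
  one := mk []
  mul_assoc x y z := by
    induction x using Quotient.inductionOn
    induction y using Quotient.inductionOn
    induction z using Quotient.inductionOn
    exact congrArg mk (List.append_assoc _ _ _)
  one_mul x := by
    induction x using Quotient.inductionOn
    rfl
  mul_one x := by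
    induction x using Quotient.inductionOn
    exact congrArg mk (List.append_nil _)

instance : PartialOrder TangleClass where
  le := Quotient.lift₂ Simplifies fun _ _ _ _ h h' =>
    propext ⟨fun e => (h.2.trans e).trans h'.1, fun e => (h.1.trans e).trans h'.2⟩
  le_refl x := by
    induction x using Quotient.inductionOn
    exact Simplifies.refl _
  le_trans x y z := by
    induction x using Quotient.inductionOn
    induction y using Quotient.inductionOn
    induction z using Quotient.inductionOn
    exact Simplifies.trans
  le_antisymm x y := by
    induction x using Quotient.inductionOn
    induction y using Quotient.inductionOn
    exact fun h h' => Quotient.sound ⟨h, h'⟩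

theorem mk_nil : mk [] = 1 := rfl

theorem mk_append (u v : List Layer) : mk (u ++ v) = mk u * mk v := rfl

theorem mk_cons (x : Layer) (w : List Layer) : mk (x :: w) = mk [x] * mk w := rfl

theorem mk_le_mk {x y : List Layer} : mk x ≤ mk y ↔ Simplifies x y := Iff.rfl

instance : MulLeftMono TangleClass where
  elim x y z h := by
    induction x using Quotient.inductionOn
    induction y using Quotient.inductionOn
    induction z using Quotient.inductionOn
    exact (Simplifies.refl _).append h

instance : MulRightMono TangleClass where
  elim x y z h := by
    induction x using Quotient.inductionOn
    induction y using Quotient.inductionOn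
    induction z using Quotient.inductionOn
    exact Simplifies.append h (.refl _)

end TangleClass

/-! ### The local moves as relations between classes of words -/

theorem append_split {α : Type*} {l₁ r₁ l₂ r₂ : List α} (h : l₁ ++ r₁ = l₂ ++ r₂)
    (hl : l₁.length ≤ l₂.length) : ∃ m, l₂ = l₁ ++ m ∧ r₁ = m ++ r₂ := by
  rcases List.append_eq_append_iff.1 h with ⟨m, h₁, h₂⟩ | ⟨m, h₁, h₂⟩
  · exact ⟨m, h₁, h₂⟩
  · have : m = [] := List.length_eq_zero_iff.1 (by
      have := congrArg List.length h₁; simp at this; omega)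
    subst this
    exact ⟨[], by simp_all⟩

theorem fits_nil {a b : List Dir} : Fits [] a b ↔ a = b := Iff.rfl

theorem fits_layer_cons {i : ℕ} {p : Piece} {w : List Layer} {a b : List Dir} :
    Fits (⟨i, p⟩ :: w) a b ↔
      ∃ l r, l.length = i ∧ a = l ++ p.bot ++ r ∧ Fits w (l ++ p.top ++ r) b := by
  constructor
  · rintro ⟨_, ⟨l, r, hl, rfl, rfl⟩, h⟩
    exact ⟨l, r, hl, rfl, h⟩
  · rintro ⟨l, r, hl, rfl, h⟩
    exact ⟨_, ⟨l, r, hl, rfl, rfl⟩, h⟩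

theorem fits_pair_iff {i j : ℕ} {p q : Piece} {a b : List Dir} :
    Fits [⟨i, p⟩, ⟨j, q⟩] a b ↔ ∃ l r l' r', l.length = i ∧ l'.length = j ∧
      a = l ++ p.bot ++ r ∧ l ++ p.top ++ r = l' ++ q.bot ++ r' ∧ b = l' ++ q.top ++ r' := by
  constructor
  · intro h
    obtain ⟨l, r, hl, rfl, h₁⟩ := fits_layer_cons.1 h
    obtain ⟨l', r', hl', e, h₂⟩ := fits_layer_cons.1 h₁
    exact ⟨l, r, l', r', hl, hl', rfl, e, h₂.symm⟩
  · rintro ⟨l, r, l', r', hl, hl', rfl, e, rfl⟩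
    exact fits_layer_cons.2 ⟨l, r, hl, rfl, fits_layer_cons.2 ⟨l', r', hl', e, rfl⟩⟩

theorem fits_exchange_iff (i n : ℕ) (p q : Piece) (a b : List Dir) :
    Fits [⟨i, p⟩, ⟨i + p.top.length + n, q⟩] a b ↔
      Fits [⟨i + p.bot.length + n, q⟩, ⟨i, p⟩] a b := by
  rw [fits_pair_iff, fits_pair_iff]
  constructor
  · rintro ⟨l, r, l', r', hl, hl', rfl, e, rfl⟩
    rw [List.append_assoc l'] at e
    obtain ⟨m, rfl, rfl⟩ := append_split e (by simp; omega)
    exact ⟨l ++ p.bot ++ m, r', l, m ++ q.top ++ r', by simp at hl' ⊢; omega, hl, by simp, by simp,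
      by simp⟩
  · rintro ⟨l, r, l', r', hl, hl', rfl, e, rfl⟩
    rw [List.append_assoc l] at e
    obtain ⟨m, rfl, e'⟩ := append_split e.symm (by simp; omega)
    subst e'
    exact ⟨l', m ++ q.bot ++ r, l' ++ p.top ++ m, r, hl', by simp at hl ⊢; omega, by simp, by simp,
      by simp⟩

theorem Dir.rev_rev (s : Dir) : s.rev.rev = s := by cases s <;> rfl

theorem Kind.flip_flip (k : Kind) : k.flip.flip = k := by cases k <;> rfl

theorem fits_cup_cons {i : ℕ} {s : Dir} {w : List Layer} {a b : List Dir} :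
    Fits (⟨i, .cup s⟩ :: w) a b ↔
      ∃ l r, l.length = i ∧ a = l ++ r ∧ Fits w (l ++ s :: s.rev :: r) b := by
  simp [fits_layer_cons, Piece.bot, Piece.top]

theorem fits_cap_cons {i : ℕ} {s : Dir} {w : List Layer} {a b : List Dir} :
    Fits (⟨i, .cap s⟩ :: w) a b ↔
      ∃ l r, l.length = i ∧ a = l ++ s :: s.rev :: r ∧ Fits w (l ++ r) b := by
  simp [fits_layer_cons, Piece.bot, Piece.top]

theorem fits_cross_cons {i : ℕ} {k : Kind} {s t : Dir} {w : List Layer} {a b : List Dir} :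
    Fits (⟨i, .cross k s t⟩ :: w) a b ↔
      ∃ l r, l.length = i ∧ a = l ++ s :: t :: r ∧ Fits w (l ++ t :: s :: r) b := by
  simp [fits_layer_cons, Piece.bot, Piece.top]

theorem append_cons_split {α : Type*} {l r l' r' : List α} {x : α} (h : l ++ x :: r = l' ++ r')
    (hl : l'.length = l.length + 1) : l' = l ++ [x] ∧ r = r' := by
  rw [← List.singleton_append, ← List.append_assoc] at h
  have := List.append_inj h (by simp [hl])
  exact ⟨this.1.symm, this.2⟩

theorem fits_slideCap_left {i : ℕ} {k : Kind} {s t : Dir} {a b : List Dir} :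
    Fits [⟨i, .cross k s t⟩, ⟨i + 1, .cap s⟩] a b ↔
      ∃ l r, l.length = i ∧ a = l ++ s :: t :: s.rev :: r ∧ b = l ++ t :: r := by
  simp only [fits_cross_cons, fits_cap_cons, fits_nil]
  constructor
  · rintro ⟨l, r, hl, rfl, l', r', hl', e, rfl⟩
    obtain ⟨rfl, e₁⟩ := append_cons_split e (by omega)
    simp only [List.cons.injEq, true_and] at e₁
    exact ⟨l, r', hl, by simp [e₁], by simp⟩
  · rintro ⟨l, r, hl, rfl, rfl⟩
    exact ⟨l, _, hl, rfl, l ++ [t], r, by simp [hl], by simp, by simp⟩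

theorem fits_slideCap_right {i : ℕ} {k : Kind} {s t : Dir} {a b : List Dir} :
    Fits [⟨i + 1, .cross k t s.rev⟩, ⟨i, .cap s⟩] a b ↔
      ∃ l r, l.length = i ∧ a = l ++ s :: t :: s.rev :: r ∧ b = l ++ t :: r := by
  simp only [fits_cross_cons, fits_cap_cons, fits_nil]
  constructor
  · rintro ⟨l, r, hl, rfl, l', r', hl', e, rfl⟩
    obtain ⟨rfl, e₁⟩ := append_cons_split e.symm (by omega)
    simp only [List.cons.injEq, true_and] at e₁
    exact ⟨l', r, hl', by simp, by simp [e₁]⟩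
  · rintro ⟨l, r, hl, rfl, rfl⟩
    exact ⟨l ++ [s], r, by simp [hl], by simp, l, _, hl, by simp, rfl⟩

theorem fits_slideCup_left {i : ℕ} {k : Kind} {s t : Dir} {a b : List Dir} :
    Fits [⟨i + 1, .cup s⟩, ⟨i, .cross k t s⟩] a b ↔
      ∃ l r, l.length = i ∧ a = l ++ t :: r ∧ b = l ++ s :: t :: s.rev :: r := by
  simp only [fits_cross_cons, fits_cup_cons, fits_nil]
  constructor
  · rintro ⟨l, r, hl, rfl, l', r', hl', e, rfl⟩
    obtain ⟨rfl, e₁⟩ := append_cons_split e.symm (by omega)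
    simp only [List.cons.injEq, true_and] at e₁
    exact ⟨l', r, hl', by simp, by simp [e₁]⟩
  · rintro ⟨l, r, hl, rfl, rfl⟩
    exact ⟨l ++ [t], r, by simp [hl], by simp, l, _, hl, by simp, rfl⟩

theorem fits_slideCup_right {i : ℕ} {k : Kind} {s t : Dir} {a b : List Dir} :
    Fits [⟨i, .cup s⟩, ⟨i + 1, .cross k s.rev t⟩] a b ↔
      ∃ l r, l.length = i ∧ a = l ++ t :: r ∧ b = l ++ s :: t :: s.rev :: r := by
  simp only [fits_cross_cons, fits_cup_cons, fits_nil]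
  constructor
  · rintro ⟨l, r, hl, rfl, l', r', hl', e, rfl⟩
    obtain ⟨rfl, e₁⟩ := append_cons_split e (by omega)
    simp only [List.cons.injEq, true_and] at e₁
    exact ⟨l, r', hl, by simp [e₁], by simp⟩
  · rintro ⟨l, r, hl, rfl, rfl⟩
    exact ⟨l, _, hl, rfl, l ++ [s], r, by simp [hl], by simp, by simp⟩

theorem fits_bigon_iff {i : ℕ} {k k' : Kind} {s t : Dir} {a b : List Dir} :
    Fits [⟨i, .cross k s t⟩, ⟨i, .cross k' t s⟩] a b ↔
      ∃ l r, l.length = i ∧ a = l ++ s :: t :: r ∧ b = l ++ s :: t :: r := by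
  simp only [fits_cross_cons, fits_nil]
  constructor
  · rintro ⟨l, r, hl, rfl, l', r', hl', e, rfl⟩
    obtain ⟨rfl, e₁⟩ := List.append_inj e (by omega)
    simp only [List.cons.injEq, true_and] at e₁
    exact ⟨l, r, hl, rfl, by simp [e₁]⟩
  · rintro ⟨l, r, hl, rfl, rfl⟩
    exact ⟨l, r, hl, rfl, l, r, hl, rfl, rfl⟩

theorem fits_triangle_left {i : ℕ} {k₁₂ k₁₃ k₂₃ : Kind} {s t u : Dir} {a b : List Dir} :
    Fits [⟨i, .cross k₁₂ s t⟩, ⟨i + 1, .cross k₁₃ s u⟩, ⟨i, .cross k₂₃ t u⟩] a b ↔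
      ∃ l r, l.length = i ∧ a = l ++ s :: t :: u :: r ∧ b = l ++ u :: t :: s :: r := by
  simp only [fits_cross_cons, fits_nil]
  constructor
  · rintro ⟨l, r, hl, rfl, l', r', hl', e, l'', r'', hl'', e', rfl⟩
    obtain ⟨rfl, e₁⟩ := append_cons_split e (by omega)
    simp only [List.cons.injEq, true_and] at e₁
    rw [List.append_assoc] at e'
    obtain ⟨rfl, e₂⟩ := List.append_inj e' (by omega)
    simp at e₂
    exact ⟨l, r', hl, by simp [e₁], by simp [e₂]⟩
  · rintro ⟨l, r, hl, rfl, rfl⟩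
    exact ⟨l, _, hl, rfl, l ++ [t], r, by simp [hl], by simp, l, _, hl, by simp, rfl⟩

theorem fits_triangle_right {i : ℕ} {k₁₂ k₁₃ k₂₃ : Kind} {s t u : Dir} {a b : List Dir} :
    Fits [⟨i + 1, .cross k₂₃ t u⟩, ⟨i, .cross k₁₃ s u⟩, ⟨i + 1, .cross k₁₂ s t⟩] a b ↔
      ∃ l r, l.length = i ∧ a = l ++ s :: t :: u :: r ∧ b = l ++ u :: t :: s :: r := by
  simp only [fits_cross_cons, fits_nil]
  constructor
  · rintro ⟨l, r, hl, rfl, l', r', hl', e, l'', r'', hl'', e', rfl⟩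
    obtain ⟨rfl, e₁⟩ := append_cons_split e.symm (by omega)
    simp only [List.cons.injEq, true_and] at e₁
    obtain ⟨rfl, e₂⟩ := append_cons_split e' (by omega)
    simp only [List.cons.injEq, true_and] at e₂
    exact ⟨l', r, by omega, by simp, by simpa [e₂] using e₁⟩
  · rintro ⟨l, r, hl, rfl, rfl⟩
    exact ⟨l ++ [s], r, by simp [hl], by simp, l, t :: r, hl, by simp, l ++ [u], r, by simp [hl],
      by simp, by simp⟩

namespace TangleClass

theorem mk_eq_mk {x y : List Layer} (hm : Move x y) (hf : ∀ a b, Fits x a b ↔ Fits y a b) :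
    mk x = mk y :=
  le_antisymm (Simplifies.of_move hm fun a b => (hf a b).1)
    (Simplifies.of_move_symm hm fun a b => (hf a b).2)

/-- Two words that fit between the same levels and have a common upper bound are equal.  This yields
equations from moves that are mere inequalities, such as the bigon. -/
theorem mk_eq_mk_of_le {x y : List Layer} {z : TangleClass} (hx : mk x ≤ z) (hy : mk y ≤ z)
    (hf : ∀ a b, Fits x a b ↔ Fits y a b) : mk x = mk y := by
  induction z using Quotient.inductionOn
  exact le_antisymm (Simplifies.of_common hx hy fun a b => (hf a b).1)
    (Simplifies.of_common hy hx fun a b => (hf a b).2)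

/-- A crossing, with `i` strands to its left. -/
def cross (i : ℕ) (k : Kind) (s t : Dir) : TangleClass := mk [⟨i, .cross k s t⟩]

/-- A minimum, with `i` strands to its left. -/
def cup (i : ℕ) (s : Dir) : TangleClass := mk [⟨i, .cup s⟩]

/-- A maximum, with `i` strands to its left. -/
def cap (i : ℕ) (s : Dir) : TangleClass := mk [⟨i, .cap s⟩]

theorem exchange (i n : ℕ) (p q : Piece) :
    mk [⟨i, p⟩] * mk [⟨i + p.top.length + n, q⟩] = mk [⟨i + p.bot.length + n, q⟩] * mk [⟨i, p⟩] :=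
  mk_eq_mk (.exchange i n p q) (fits_exchange_iff i n p q)

theorem slideCap (i : ℕ) (k : Kind) (s t : Dir) :
    cross i k s t * cap (i + 1) s = cross (i + 1) k.flip t s.rev * cap i s :=
  mk_eq_mk (.slideCap i k s t) fun _ _ => fits_slideCap_left.trans fits_slideCap_right.symm

theorem slideCup (i : ℕ) (k : Kind) (s t : Dir) :
    cup (i + 1) s * cross i k t s = cup i s * cross (i + 1) k.flip s.rev t :=
  mk_eq_mk (.slideCup i k s t) fun _ _ => fits_slideCup_left.trans fits_slideCup_right.symm

theorem triangle (i : ℕ) {k₁₂ k₁₃ k₂₃ : Kind} (h : Triangle k₁₂ k₁₃ k₂₃) (s t u : Dir) :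
    cross i k₁₂ s t * (cross (i + 1) k₁₃ s u * cross i k₂₃ t u) =
      cross (i + 1) k₂₃ t u * (cross i k₁₃ s u * cross (i + 1) k₁₂ s t) :=
  mk_eq_mk (.triangle i _ _ _ h s t u) fun _ _ => fits_triangle_left.trans fits_triangle_right.symm

theorem bigon_le (i : ℕ) (k : Kind) (s t : Dir) : cross i k s t * cross i k.flip t s ≤ 1 :=
  Simplifies.of_move (.bigon i k s t) fun a b h => by
    obtain ⟨l, r, -, rfl, rfl⟩ := fits_bigon_iff.1 h
    rfl

theorem zigzagRight_le (i : ℕ) (s : Dir) : cup (i + 1) s.rev * cap i s ≤ 1 :=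
  Simplifies.of_move (.zigzagRight i s) fun a b h => by
    obtain ⟨l, r, hl, rfl, h₁⟩ := fits_cup_cons.1 h
    obtain ⟨l', r', hl', e, rfl⟩ := fits_cap_cons.1 h₁
    obtain ⟨rfl, e₁⟩ := append_cons_split e.symm (by omega)
    simp only [List.cons.injEq, true_and] at e₁
    simp [fits_nil, e₁, Dir.rev_rev]

theorem zigzagLeft_le (i : ℕ) (s : Dir) : cup i s * cap (i + 1) s.rev ≤ 1 :=
  Simplifies.of_move (.zigzagLeft i s) fun a b h => by
    obtain ⟨l, r, hl, rfl, h₁⟩ := fits_cup_cons.1 h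
    obtain ⟨l', r', hl', e, rfl⟩ := fits_cap_cons.1 h₁
    obtain ⟨rfl, e₁⟩ := append_cons_split e (by omega)
    simp only [List.cons.injEq, true_and] at e₁
    simp [fits_nil, e₁, Dir.rev_rev]

theorem curlRight_le (i : ℕ) (k : Kind) (s : Dir) :
    cup (i + 1) s * (cross i k s s * cap (i + 1) s) ≤ 1 :=
  Simplifies.of_move (.curlRight i k s) fun a b h => by
    obtain ⟨l, r, hl, rfl, h₁⟩ := fits_cup_cons.1 h
    obtain ⟨l', r', hl', e, rfl⟩ := fits_slideCap_left.1 h₁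
    obtain ⟨rfl, e₁⟩ := append_cons_split e.symm (by omega)
    simp only [List.cons.injEq, true_and] at e₁
    simp [fits_nil, e₁]

theorem curlLeft_le (i : ℕ) (k : Kind) (s : Dir) :
    cup i s.rev * (cross (i + 1) k s s * cap i s.rev) ≤ 1 :=
  Simplifies.of_move (.curlLeft i k s) fun a b h => by
    obtain ⟨l, r, hl, rfl, h₁⟩ := fits_cup_cons.1 h
    obtain ⟨l', r', hl', e, rfl⟩ := (fits_slideCap_right (s := s.rev)).1
      (by rw [Dir.rev_rev]; exact h₁)
    obtain ⟨rfl, e₁⟩ := List.append_inj e (by omega)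
    simp only [List.cons.injEq, true_and, Dir.rev_rev] at e₁
    simp [fits_nil, e₁]

end TangleClass

namespace TangleClass

theorem cross_cross {i j : ℕ} (h : i + 2 ≤ j) (k k' : Kind) (s t s' t' : Dir) :
    cross i k s t * cross j k' s' t' = cross j k' s' t' * cross i k s t := by
  obtain ⟨n, rfl⟩ := Nat.exists_eq_add_of_le h
  exact exchange i n (.cross k s t) (.cross k' s' t')

theorem cap_cap {i j : ℕ} (h : i ≤ j) (s t : Dir) : cap i s * cap j t = cap (j + 2) t * cap i s := by
  obtain ⟨n, rfl⟩ := Nat.exists_eq_add_of_le h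
  rw [show i + n + 2 = i + 2 + n by omega]
  exact exchange i n (.cap s) (.cap t)

theorem cup_cup {i j : ℕ} (h : i ≤ j) (s t : Dir) : cup i s * cup (j + 2) t = cup j t * cup i s := by
  obtain ⟨n, rfl⟩ := Nat.exists_eq_add_of_le h
  rw [show i + n + 2 = i + 2 + n by omega]
  exact exchange i n (.cup s) (.cup t)

theorem cup_cap {i j : ℕ} (h : i ≤ j) (s t : Dir) : cup i s * cap (j + 2) t = cap j t * cup i s := by
  obtain ⟨n, rfl⟩ := Nat.exists_eq_add_of_le h
  rw [show i + n + 2 = i + 2 + n by omega]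
  exact exchange i n (.cup s) (.cap t)

theorem cap_cup {i j : ℕ} (h : i ≤ j) (s t : Dir) : cap i s * cup j t = cup (j + 2) t * cap i s := by
  obtain ⟨n, rfl⟩ := Nat.exists_eq_add_of_le h
  rw [show i + n + 2 = i + 2 + n by omega]
  exact exchange i n (.cap s) (.cup t)

theorem mul_tail {a b c d : TangleClass} (h : a * b = c * d) (x : TangleClass) :
    a * (b * x) = c * (d * x) := by
  rw [← mul_assoc, h, mul_assoc]

theorem mul_tail₃ {a b c d e f : TangleClass} (h : a * (b * c) = d * (e * f)) (x : TangleClass) :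
    a * (b * (c * x)) = d * (e * (f * x)) := by
  have := congrArg (· * x) h
  simpa only [mul_assoc] using this

end TangleClass

/-! ### Strands crossing a pair of strands -/

/-- One of the two copies of a strand at a level: its direction, and whether it is the main copy. -/
structure Copy where
  dir : Dir
  main : Bool

/-- The copy on the left of the page of a strand of direction `s`. -/
def Sense.leftCopy (o : Sense) (s : Dir) : Copy := ⟨o.left s, leftIsMain s⟩

/-- The copy on the right of the page of a strand of direction `s`. -/
def Sense.rightCopy (o : Sense) (s : Dir) : Copy := ⟨o.right s, rightIsMain s⟩

theorem triangle_iff {a b c : Kind} : Triangle a b c ↔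
    (a ≠ .virt ∧ b ≠ .virt ∧ c ≠ .virt ∧ ¬ (a = c ∧ b = a.flip)) ∨ (a = .virt ∧ b = .virt) ∨
      (a = .virt ∧ c = .virt) ∨ (b = .virt ∧ c = .virt) ∨ (a = .over ∧ b = .over ∧ c = .virt) ∨
      (a = .under ∧ b = .virt ∧ c = .over) ∨ (a = .virt ∧ b = .under ∧ c = .under) := by
  constructor
  · rintro (⟨h₁, h₂, h₃, h₄⟩ | _ | h | h | h | _ | _ | _) <;> simp_all
  · rintro (⟨h₁, h₂, h₃, h₄⟩ | ⟨rfl, rfl⟩ | ⟨rfl, rfl⟩ | ⟨rfl, rfl⟩ | ⟨rfl, rfl, rfl⟩ |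
      ⟨rfl, rfl, rfl⟩ | ⟨rfl, rfl, rfl⟩)
    · exact .classical _ _ _ h₁ h₂ h₃ h₄
    · by_cases h : c = .virt
      · exact h ▸ .virtual
      · exact .mixed₁ _ h
    · by_cases h : b = .virt
      · exact h ▸ .virtual
      · exact .mixed₂ _ h
    · by_cases h : a = .virt
      · exact h ▸ .virtual
      · exact .mixed₃ _ h
    · exact .welded₁
    · exact .welded₂
    · exact .welded₃

instance (a b c : Kind) : Decidable (Triangle a b c) := decidable_of_iff _ triangle_iff.symm

/-- If a triangle move is allowed for three strands, then it is allowed for all copies of them. -/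
theorem Triangle.copy {k₁₂ k₁₃ k₂₃ : Kind} (h : Triangle k₁₂ k₁₃ k₂₃) (x y z : Bool) :
    Triangle (copyKind k₁₂ x y) (copyKind k₁₃ x z) (copyKind k₂₃ y z) := by
  revert h
  cases k₁₂ <;> cases k₁₃ <;> cases k₂₃ <;> cases x <;> cases y <;> cases z <;> decide

/-- A copy of another strand may be pushed across a crossing of the two copies of one strand,
provided that the main copy is not under at that crossing: by Reidemeister move III, virtual move III
or IV, or the welded move, according to which of the copies take part in classical crossings. -/
theorem triangle_copies_left {x y : Bool} (h : x ≠ y) (κ k : Kind) (z : Bool) :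
    Triangle (copyKind κ x y) (copyKind k x z) (copyKind k y z) := by
  revert h
  cases x <;> cases y <;> cases κ <;> cases k <;> cases z <;> decide

/-- The mirror image of `triangle_copies_left`, with the other strand on the left. -/
theorem triangle_copies_right {y z : Bool} (h : y ≠ z) (κ k : Kind) (x : Bool) :
    Triangle (copyKind k x y) (copyKind k x z) (copyKind κ y z) := by
  revert h
  cases y <;> cases z <;> cases κ <;> cases k <;> cases x <;> decide

namespace TangleClass

/-- The crossing of two copies whose original strands cross in a crossing of kind `k`. -/
def copyCross (j : ℕ) (k : Kind) (c d : Copy) : TangleClass :=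
  cross j (copyKind k c.main d.main) c.dir d.dir

/-- The copy `c` passes from the left to the right of the pair `p`, `q`. -/
def row (j : ℕ) (k : Kind) (c p q : Copy) : TangleClass :=
  copyCross j k c p * copyCross (j + 1) k c q

/-- The copy `c` passes from the right to the left of the pair `p`, `q`. -/
def column (j : ℕ) (k : Kind) (p q c : Copy) : TangleClass :=
  copyCross (j + 1) k q c * copyCross j k p c

theorem copyCross_comm {i j : ℕ} (h : i + 2 ≤ j) (k k' : Kind) (c d c' d' : Copy) :
    copyCross i k c d * copyCross j k' c' d' = copyCross j k' c' d' * copyCross i k c d :=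
  cross_cross h ..

theorem copyCross_mul_cap {i j : ℕ} (h : i + 2 ≤ j) (k : Kind) (c d : Copy) (u : Dir) :
    copyCross i k c d * cap j u = cap j u * copyCross i k c d := by
  obtain ⟨n, rfl⟩ := Nat.exists_eq_add_of_le h
  exact exchange i n (.cross _ _ _) (.cap u)

theorem cup_mul_copyCross {i j : ℕ} (h : i + 2 ≤ j) (k : Kind) (c d : Copy) (u : Dir) :
    cup j u * copyCross i k c d = copyCross i k c d * cup j u := by
  obtain ⟨n, rfl⟩ := Nat.exists_eq_add_of_le h
  exact (exchange i n (.cross _ _ _) (.cup u)).symm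

theorem cap_mul_copyCross {i j : ℕ} (h : i ≤ j) (k : Kind) (c d : Copy) (u : Dir) :
    cap i u * copyCross j k c d = copyCross (j + 2) k c d * cap i u := by
  obtain ⟨n, rfl⟩ := Nat.exists_eq_add_of_le h
  rw [show i + n + 2 = i + 2 + n by omega]
  exact exchange i n (.cap u) (.cross _ _ _)

theorem copyCross_mul_cup {i j : ℕ} (h : i ≤ j) (k : Kind) (c d : Copy) (u : Dir) :
    copyCross j k c d * cup i u = cup i u * copyCross (j + 2) k c d := by
  obtain ⟨n, rfl⟩ := Nat.exists_eq_add_of_le h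
  rw [show i + n + 2 = i + 2 + n by omega]
  exact (exchange i n (.cup u) (.cross _ _ _)).symm

theorem row_mul_cap {i j : ℕ} (h : i + 3 ≤ j) (k : Kind) (c p q : Copy) (u : Dir) :
    row i k c p q * cap j u = cap j u * row i k c p q := by
  rw [row, mul_assoc, copyCross_mul_cap (by omega), mul_tail (copyCross_mul_cap (by omega) ..)]

theorem cup_mul_column {i j : ℕ} (h : i + 3 ≤ j) (k : Kind) (c p q : Copy) (u : Dir) :
    cup j u * column i k p q c = column i k p q c * cup j u := by
  rw [column, mul_tail (cup_mul_copyCross (by omega) ..), cup_mul_copyCross (by omega), mul_assoc]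

theorem cap_mul_column {i j : ℕ} (h : i ≤ j) (k : Kind) (c p q : Copy) (u : Dir) :
    cap i u * column j k p q c = column (j + 2) k p q c * cap i u := by
  rw [column, mul_tail (cap_mul_copyCross (by omega) ..), cap_mul_copyCross h, column, mul_assoc]

theorem row_mul_cup {i j : ℕ} (h : i ≤ j) (k : Kind) (c p q : Copy) (u : Dir) :
    row j k c p q * cup i u = cup i u * row (j + 2) k c p q := by
  rw [row, mul_assoc, copyCross_mul_cup (by omega), mul_tail (copyCross_mul_cup h ..), row]

theorem copyCross_row {i j : ℕ} (h : i + 2 ≤ j) (k k' : Kind) (c d e p q : Copy) :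
    copyCross i k c d * row j k' e p q = row j k' e p q * copyCross i k c d := by
  rw [row, mul_tail (copyCross_comm h ..), copyCross_comm (by omega), mul_assoc]

theorem row_copyCross {i j : ℕ} (h : i + 3 ≤ j) (k k' : Kind) (c d e p q : Copy) :
    row i k' e p q * copyCross j k c d = copyCross j k c d * row i k' e p q := by
  rw [row, mul_assoc, copyCross_comm (by omega), mul_tail (copyCross_comm (by omega) ..)]

/-- A crossing of two strands passes a pair of strands that both of them cross. -/
theorem copyCross_row_row (j : ℕ) {κ k k' : Kind} {c d p q : Copy}
    (hp : Triangle (copyKind κ c.main d.main) (copyKind k c.main p.main) (copyKind k' d.main p.main))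
    (hq : Triangle (copyKind κ c.main d.main) (copyKind k c.main q.main) (copyKind k' d.main q.main)) :
    copyCross j κ c d * (row (j + 1) k c p q * row j k' d p q) =
      row (j + 1) k' d p q * (row j k c p q * copyCross (j + 2) κ c d) := by
  have e₁ : copyCross j κ c d * (copyCross (j + 1) k c p * copyCross j k' d p) = _ :=
    triangle j hp ..
  have e₂ : copyCross (j + 1) κ c d * (copyCross (j + 2) k c q * copyCross (j + 1) k' d q) = _ :=
    triangle (j + 1) hq ..
  simp only [row, mul_assoc]
  rw [mul_tail (copyCross_comm (le_refl (j + 2)) k' k d p c q).symm, mul_tail₃ e₁]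
  simp only [copyCross] at e₂ ⊢
  rw [e₂, mul_tail (cross_cross (le_refl (j + 2)) ..)]

/-- The mirror image of `copyCross_row_row`. -/
theorem copyCross_column_column (j : ℕ) {κ k k' : Kind} {p q c d : Copy}
    (hp : Triangle (copyKind k p.main c.main) (copyKind k' p.main d.main) (copyKind κ c.main d.main))
    (hq : Triangle (copyKind k q.main c.main) (copyKind k' q.main d.main) (copyKind κ c.main d.main)) :
    copyCross (j + 2) κ c d * (column j k' p q d * column (j + 1) k p q c) =
      column j k p q c * (column (j + 1) k' p q d * copyCross j κ c d) := by
  have e₁ : _ = copyCross (j + 2) κ c d * (copyCross (j + 1) k' q d * copyCross (j + 2) k q c) :=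
    triangle (j + 1) hq ..
  have e₂ : _ = copyCross (j + 1) κ c d * (copyCross j k' p d * copyCross (j + 1) k p c) :=
    triangle j hp ..
  simp only [column, mul_assoc]
  rw [mul_tail (copyCross_comm (le_refl (j + 2)) k' k p d q c), mul_tail₃ e₁.symm]
  simp only [copyCross] at e₂ ⊢
  rw [← e₂, mul_tail (cross_cross (le_refl (j + 2)) ..).symm]

/-- The class of the tangle formed by the crossings of the copies of two strands. -/
def grid (o : Sense) (j : ℕ) (k : Kind) (s t : Dir) : TangleClass :=
  column j k (o.leftCopy s) (o.rightCopy s) (o.leftCopy t) *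
    column (j + 1) k (o.leftCopy s) (o.rightCopy s) (o.rightCopy t)

theorem mk_grid (o : Sense) (i : ℕ) (k : Kind) (s t : Dir) :
    mk (WeldedLinks.grid o i k s t) = grid o (2 * i) k s t := rfl

theorem grid_eq_rows (o : Sense) (j : ℕ) (k : Kind) (s t : Dir) :
    grid o j k s t = row (j + 1) k (o.rightCopy s) (o.leftCopy t) (o.rightCopy t) *
      row j k (o.leftCopy s) (o.leftCopy t) (o.rightCopy t) := by
  simp only [grid, row, column, mul_assoc]
  rw [mul_tail (copyCross_comm (le_refl (j + 2)) ..)]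

/-- The two copies of a strand of direction `s` cross twice, at crossings of kinds `κ` and `κ'`
which become virtual if the main copy would be under. -/
def copyTwist (o : Sense) (j : ℕ) (κ κ' : Kind) (s : Dir) : TangleClass :=
  copyCross j κ (o.leftCopy s) (o.rightCopy s) * copyCross j κ' (o.rightCopy s) (o.leftCopy s)

theorem leftIsMain_ne (s : Dir) : leftIsMain s ≠ rightIsMain s := by cases s <;> decide

/-- A twist on the copies of the strand starting on the left passes the grid. -/
theorem copyTwist_grid (o : Sense) (j : ℕ) (κ κ' k : Kind) (s t : Dir) :
    copyTwist o j κ κ' s * grid o j k s t = grid o j k s t * copyTwist o (j + 2) κ κ' s := by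
  rw [grid_eq_rows, copyTwist, copyTwist, mul_assoc]
  have h := copyCross_row_row j (κ := κ') (k := k) (k' := k) (c := o.rightCopy s) (d := o.leftCopy s)
    (p := o.leftCopy t) (q := o.rightCopy t)
    (triangle_copies_left (leftIsMain_ne s).symm ..) (triangle_copies_left (leftIsMain_ne s).symm ..)
  have h' := copyCross_row_row j (κ := κ) (k := k) (k' := k) (c := o.leftCopy s) (d := o.rightCopy s)
    (p := o.leftCopy t) (q := o.rightCopy t)
    (triangle_copies_left (leftIsMain_ne s) ..) (triangle_copies_left (leftIsMain_ne s) ..)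
  rw [h, mul_tail₃ h']
  simp only [mul_assoc]

/-- A twist on the copies of the strand starting on the right passes the grid. -/
theorem copyTwist_grid_right (o : Sense) (j : ℕ) (κ κ' k : Kind) (s t : Dir) :
    copyTwist o (j + 2) κ κ' t * grid o j k s t = grid o j k s t * copyTwist o j κ κ' t := by
  rw [grid, copyTwist, copyTwist, mul_assoc]
  have h := copyCross_column_column j (κ := κ') (k := k) (k' := k) (c := o.rightCopy t)
    (d := o.leftCopy t) (p := o.leftCopy s) (q := o.rightCopy s)
    (triangle_copies_right (leftIsMain_ne t).symm ..) (triangle_copies_right (leftIsMain_ne t).symm ..)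
  have h' := copyCross_column_column j (κ := κ) (k := k) (k' := k) (c := o.leftCopy t)
    (d := o.rightCopy t) (p := o.leftCopy s) (q := o.rightCopy s)
    (triangle_copies_right (leftIsMain_ne t) ..) (triangle_copies_right (leftIsMain_ne t) ..)
  rw [h, mul_tail₃ h']
  simp only [mul_assoc]

theorem copyCross_grid {i j : ℕ} (h : i + 2 ≤ j ∨ j + 4 ≤ i) (o : Sense) (κ k : Kind) (c d : Copy)
    (s t : Dir) : copyCross i κ c d * grid o j k s t = grid o j k s t * copyCross i κ c d := by
  have hc : ∀ (m : ℕ) (k' : Kind) (c' d' : Copy), j ≤ m → m ≤ j + 2 →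
      copyCross i κ c d * copyCross m k' c' d' = copyCross m k' c' d' * copyCross i κ c d := by
    intro m k' c' d' h₁ h₂
    rcases h with h | h
    · exact copyCross_comm (by omega) ..
    · exact (copyCross_comm (by omega) ..).symm
  simp only [grid, column, mul_assoc]
  rw [mul_tail (hc (j + 1) _ _ _ (by omega) (by omega)), mul_tail (hc j _ _ _ (by omega) (by omega)),
    mul_tail (hc (j + 1 + 1) _ _ _ (by omega) (by omega)), hc (j + 1) _ _ _ (by omega) (by omega)]

theorem copyTwist_grid_far {i j : ℕ} (h : i + 2 ≤ j ∨ j + 4 ≤ i) (o : Sense) (κ κ' k : Kind)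
    (s t u : Dir) :
    copyTwist o i κ κ' u * grid o j k s t = grid o j k s t * copyTwist o i κ κ' u := by
  rw [copyTwist, mul_assoc, copyCross_grid h, mul_tail (copyCross_grid h ..)]

/-- The doubled triangle moves without the twists: the four crossings of the first grid pass, one
after the other, the pair of copies of the third strand. -/
theorem grid_triangle (o : Sense) (j : ℕ) {k₁₂ k₁₃ k₂₃ : Kind} (h : Triangle k₁₂ k₁₃ k₂₃)
    (s t u : Dir) :
    grid o j k₁₂ s t * (grid o (j + 2) k₁₃ s u * grid o j k₂₃ t u) =
      grid o (j + 2) k₂₃ t u * (grid o j k₁₃ s u * grid o (j + 2) k₁₂ s t) := by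
  have far : ∀ (m n : ℕ) (k : Kind) (c d e : Copy) (x : TangleClass), m + 2 ≤ n ∨ n + 3 ≤ m →
      copyCross m k₁₂ c d * (row n k e (o.leftCopy u) (o.rightCopy u) * x) =
        row n k e (o.leftCopy u) (o.rightCopy u) * (copyCross m k₁₂ c d * x) := by
    intro m n k c d e x hmn
    rcases hmn with hmn | hmn
    · exact mul_tail (copyCross_row hmn ..) x
    · exact mul_tail (row_copyCross hmn ..).symm x
  have near : ∀ (m : ℕ) (c d : Copy) (x : TangleClass), copyCross m k₁₂ c d *
      (row (m + 1) k₁₃ c (o.leftCopy u) (o.rightCopy u) *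
        (row m k₂₃ d (o.leftCopy u) (o.rightCopy u) * x)) =
      row (m + 1) k₂₃ d (o.leftCopy u) (o.rightCopy u) *
        (row m k₁₃ c (o.leftCopy u) (o.rightCopy u) * (copyCross (m + 2) k₁₂ c d * x)) :=
    fun m c d x => mul_tail₃ (copyCross_row_row m (h.copy ..) (h.copy ..)) x
  rw [grid_eq_rows o (j + 2) k₁₃, grid_eq_rows o j k₂₃, grid_eq_rows o (j + 2) k₂₃,
    grid_eq_rows o j k₁₃]
  generalize o.leftCopy u = p at *
  generalize o.rightCopy u = q at *
  -- a trailing factor `1` brings every product into the form that `far` and `near` rewrite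
  rw [← mul_one (grid o j k₁₂ s t * _), ← mul_one (grid o (j + 2) k₁₂ s t)]
  simp only [grid, column, mul_assoc]
  -- the four crossings of the first grid move up, the last one first
  rw [far (j + 1) (j + 2 + 1) _ _ _ _ _ (by omega), near (j + 1), far (j + 1 + 2) j _ _ _ _ _ (by omega)]
  rw [near (j + 1 + 1), far (j + 1 + 1 + 2) (j + 1) _ _ _ _ _ (by omega),
    far (j + 1 + 1 + 2) j _ _ _ _ _ (by omega)]
  rw [far j (j + 1 + 1 + 1) _ _ _ _ _ (by omega), far j (j + 1 + 1) _ _ _ _ _ (by omega), near j]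
  rw [far (j + 1) (j + 1 + 1 + 1) _ _ _ _ _ (by omega), near (j + 1),
    far (j + 1 + 2) j _ _ _ _ _ (by omega)]

end TangleClass

/-! ### Twists -/

theorem fits_twist_iff (o : Sense) (j : ℕ) (pos : Bool) (s : Dir) (a b : List Dir) :
    Fits (twist o j pos s) a b ↔
      ∃ l r, l.length = j ∧ a = l ++ o.left s :: o.right s :: r ∧
        b = l ++ o.left s :: o.right s :: r := by
  cases pos <;> cases s <;> exact fits_bigon_iff

namespace TangleClass

theorem exists_mk_twist (o : Sense) (pos : Bool) (s : Dir) :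
    ∃ κ κ', ∀ j, mk (twist o j pos s) = copyTwist o j κ κ' s := by
  cases pos <;> cases s
  · exact ⟨.virt, .over, fun _ => rfl⟩
  · exact ⟨.over, .virt, fun _ => rfl⟩
  · exact ⟨.under, .virt, fun _ => rfl⟩
  · exact ⟨.virt, .under, fun _ => rfl⟩

theorem twist_grid_left (o : Sense) (j : ℕ) (pos : Bool) (k : Kind) (s t : Dir) :
    mk (twist o j pos s) * grid o j k s t = grid o j k s t * mk (twist o (j + 2) pos s) := by
  obtain ⟨κ, κ', h⟩ := exists_mk_twist o pos s
  rw [h, h, copyTwist_grid]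

theorem twist_grid_right (o : Sense) (j : ℕ) (pos : Bool) (k : Kind) (s t : Dir) :
    mk (twist o (j + 2) pos t) * grid o j k s t = grid o j k s t * mk (twist o j pos t) := by
  obtain ⟨κ, κ', h⟩ := exists_mk_twist o pos t
  rw [h, h, copyTwist_grid_right]

theorem twist_grid_far {i j : ℕ} (h : i + 2 ≤ j ∨ j + 4 ≤ i) (o : Sense) (pos : Bool) (k : Kind)
    (s t u : Dir) :
    mk (twist o i pos u) * grid o j k s t = grid o j k s t * mk (twist o i pos u) := by
  obtain ⟨κ, κ', h'⟩ := exists_mk_twist o pos u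
  rw [h', copyTwist_grid_far h]

theorem bigon_bigon_le (j : ℕ) (κ κ' : Kind) (s t : Dir) :
    cross j κ s t * (cross j κ' t s * (cross j κ'.flip s t * cross j κ.flip t s)) ≤ 1 :=
  calc _ = cross j κ s t * ((cross j κ' t s * cross j κ'.flip s t) * cross j κ.flip t s) := by
        simp only [mul_assoc]
    _ ≤ cross j κ s t * (1 * cross j κ.flip t s) := by
        gcongr
        exact bigon_le _ _ _ _
    _ ≤ 1 := by
        rw [one_mul]
        exact bigon_le _ _ _ _

/-- The twists inserted at positive and at negative crossings are inverse to each other. -/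
theorem twist_mul_twist_le (o : Sense) (j : ℕ) (pos : Bool) (s : Dir) :
    mk (twist o j pos s) * mk (twist o j (!pos) s) ≤ 1 := by
  cases pos <;> cases s
  · exact bigon_bigon_le j .virt .over _ _
  · exact bigon_bigon_le j .over .virt _ _
  · exact bigon_bigon_le j .under .virt _ _
  · exact bigon_bigon_le j .virt .under _ _

/-- Twists on the same pair commute: opposite ones, because they cancel in either order. -/
theorem twist_comm_self (o : Sense) (j : ℕ) (pos pos' : Bool) (s : Dir) :
    Commute (mk (twist o j pos s)) (mk (twist o j pos' s)) := by
  by_cases h : pos' = pos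
  · rw [h]
  · obtain rfl : pos' = !pos := by cases pos <;> cases pos' <;> simp_all
    refine mk_eq_mk_of_le (z := 1) (twist_mul_twist_le o j pos s) ?_ fun a b => ?_
    · have := twist_mul_twist_le o j (!pos) s
      rwa [Bool.not_not] at this
    · change Fits (_ ++ _) a b ↔ Fits (_ ++ _) a b
      simp only [fits_append_iff, fits_twist_iff]

theorem twist_comm {i j : ℕ} (h : i + 2 ≤ j) (o : Sense) (pos pos' : Bool) (s t : Dir) :
    Commute (mk (twist o i pos s)) (mk (twist o j pos' t)) := by
  obtain ⟨κ, κ', e⟩ := exists_mk_twist o pos s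
  obtain ⟨κ₁, κ₁', e'⟩ := exists_mk_twist o pos' t
  have hc : ∀ k k' c d c' d', Commute (copyCross i k c d) (copyCross j k' c' d') :=
    fun _ _ _ _ _ _ => copyCross_comm h ..
  rw [e, e', copyTwist, copyTwist]
  exact ((hc ..).mul_right (hc ..)).mul_left ((hc ..).mul_right (hc ..))

/-- The twist that doubling inserts at a crossing of kind `k`, on the copies of the strand of
direction `s` at position `x` or of the strand of direction `t` at position `y`, whichever is the
under strand. -/
def underTwist (o : Sense) (k : Kind) (s t : Dir) (x y : ℕ) : TangleClass :=
  match k with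
  | .over => mk (twist o y (isPositive .over s t) t)
  | .under => mk (twist o x (isPositive .under s t) s)
  | .virt => 1

/-- Twists may be pushed to the other end of any tangle that lets them pass. -/
theorem underTwist_mul {o : Sense} {k : Kind} {s t : Dir} {x y x' y' : ℕ} {g : TangleClass}
    (hs : ∀ pos, mk (twist o x pos s) * g = g * mk (twist o x' pos s))
    (ht : ∀ pos, mk (twist o y pos t) * g = g * mk (twist o y' pos t)) :
    underTwist o k s t x y * g = g * underTwist o k s t x' y' := by
  cases k
  · exact ht _
  · exact hs _
  · simp [underTwist]

theorem underTwist_grid (o : Sense) (j : ℕ) (κ k : Kind) (s t : Dir) :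
    underTwist o κ s t j (j + 2) * grid o j k s t = grid o j k s t * underTwist o κ s t (j + 2) j :=
  underTwist_mul (fun _ => twist_grid_left ..) (fun _ => twist_grid_right ..)

theorem underTwist_comm {o : Sense} {k k' : Kind} {s t s' t' : Dir} {x y x' y' : ℕ}
    (h₁ : ∀ p p', Commute (mk (twist o x p s)) (mk (twist o x' p' s')))
    (h₂ : ∀ p p', Commute (mk (twist o x p s)) (mk (twist o y' p' t')))
    (h₃ : ∀ p p', Commute (mk (twist o y p t)) (mk (twist o x' p' s')))
    (h₄ : ∀ p p', Commute (mk (twist o y p t)) (mk (twist o y' p' t'))) :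
    Commute (underTwist o k s t x y) (underTwist o k' s' t' x' y') := by
  cases k <;> cases k' <;> simp only [underTwist, Commute.one_left, Commute.one_right, h₁, h₂, h₃, h₄]

/-- As a twist passes the crossing to which it belongs, doubling might always insert it below the
crossing. -/
theorem mk_doubleCross (o : Sense) (i : ℕ) (k : Kind) (s t : Dir) :
    mk (doubleCross o i k s t) =
      underTwist o k s t (2 * i) (2 * i + 2) * grid o (2 * i) k s t := by
  cases k
  · by_cases h : isPositive .over s t == (t == .up)
    · simp only [doubleCross, h, if_true, mk_append, mk_grid, underTwist]
      rw [twist_grid_right]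
    · simp only [doubleCross, h, underTwist]
      rfl
  · by_cases h : isPositive .under s t == (s == .up)
    · simp only [doubleCross, h, if_true, mk_append, mk_grid, underTwist]
      rw [twist_grid_left]
    · simp only [doubleCross, h, underTwist]
      rfl
  · simp only [doubleCross, mk_grid, underTwist, one_mul]

/-- Doubling might also always insert the twist above the crossing. -/
theorem mk_doubleCross' (o : Sense) (i : ℕ) (k : Kind) (s t : Dir) :
    mk (doubleCross o i k s t) =
      grid o (2 * i) k s t * underTwist o k s t (2 * i + 2) (2 * i) := by
  rw [mk_doubleCross, underTwist_grid]

/-! ### Doubled triangles and bigons -/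

/-- The doubled triangle moves: all twists are moved to the bottom, where they commute. -/
theorem doubleCross_triangle (o : Sense) (i : ℕ) {k₁₂ k₁₃ k₂₃ : Kind} (h : Triangle k₁₂ k₁₃ k₂₃)
    (s t u : Dir) :
    mk (doubleCross o i k₁₂ s t) *
        (mk (doubleCross o (i + 1) k₁₃ s u) * mk (doubleCross o i k₂₃ t u)) =
      mk (doubleCross o (i + 1) k₂₃ t u) *
        (mk (doubleCross o i k₁₃ s u) * mk (doubleCross o (i + 1) k₁₂ s t)) := by
  simp only [mk_doubleCross, mul_add, mul_one]
  generalize 2 * i = j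
  have e₁ : underTwist o k₂₃ t u j (j + 4) * grid o (j + 2) k₁₃ s u =
      grid o (j + 2) k₁₃ s u * underTwist o k₂₃ t u j (j + 2) :=
    underTwist_mul (fun _ => twist_grid_far (by omega) ..) fun _ => twist_grid_right ..
  have e₂ : underTwist o k₂₃ t u (j + 2) (j + 4) * grid o j k₁₂ s t =
      grid o j k₁₂ s t * underTwist o k₂₃ t u j (j + 4) :=
    underTwist_mul (fun _ => twist_grid_right ..) fun _ => twist_grid_far (by omega) ..
  have e₃ : underTwist o k₁₃ s u j (j + 4) * grid o j k₁₂ s t =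
      grid o j k₁₂ s t * underTwist o k₁₃ s u (j + 2) (j + 4) :=
    underTwist_mul (fun _ => twist_grid_left ..) fun _ => twist_grid_far (by omega) ..
  have e₄ : underTwist o k₁₂ s t j (j + 4) * grid o j k₁₃ s u =
      grid o j k₁₃ s u * underTwist o k₁₂ s t (j + 2) (j + 4) :=
    underTwist_mul (fun _ => twist_grid_left ..) fun _ => twist_grid_far (by omega) ..
  have e₅ : underTwist o k₁₂ s t j (j + 2) * grid o (j + 2) k₂₃ t u =
      grid o (j + 2) k₂₃ t u * underTwist o k₁₂ s t j (j + 4) :=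
    underTwist_mul (fun _ => twist_grid_far (by omega) ..) fun _ => twist_grid_left ..
  have e₆ : underTwist o k₁₃ s u j (j + 4) * grid o (j + 2) k₂₃ t u =
      grid o (j + 2) k₂₃ t u * underTwist o k₁₃ s u j (j + 2) :=
    underTwist_mul (fun _ => twist_grid_far (by omega) ..) fun _ => twist_grid_right ..
  have far : ∀ {m n : ℕ}, m + 2 ≤ n → ∀ (a b : Dir) (p p' : Bool),
      Commute (mk (twist o m p a)) (mk (twist o n p' b)) := fun h _ _ _ _ => twist_comm h ..
  have far' : ∀ {m n : ℕ}, m + 2 ≤ n → ∀ (a b : Dir) (p p' : Bool),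
      Commute (mk (twist o n p a)) (mk (twist o m p' b)) := fun h _ _ _ _ => (twist_comm h ..).symm
  have c₁ : Commute (underTwist o k₁₂ s t j (j + 2)) (underTwist o k₁₃ s u j (j + 4)) :=
    underTwist_comm (fun _ _ => twist_comm_self ..) (far (by omega) _ _) (far' (by omega) _ _)
      (far (by omega) _ _)
  have c₂ : Commute (underTwist o k₁₂ s t j (j + 2)) (underTwist o k₂₃ t u (j + 2) (j + 4)) :=
    underTwist_comm (far (by omega) _ _) (far (by omega) _ _) (fun _ _ => twist_comm_self ..)
      (far (by omega) _ _)
  have c₃ : Commute (underTwist o k₁₃ s u j (j + 4)) (underTwist o k₂₃ t u (j + 2) (j + 4)) :=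
    underTwist_comm (far (by omega) _ _) (far (by omega) _ _) (far' (by omega) _ _)
      (fun _ _ => twist_comm_self ..)
  simp only [mul_assoc]
  rw [mul_tail e₁.symm, mul_tail e₃.symm, mul_tail e₂.symm, grid_triangle o j h, mul_tail e₄.symm,
    mul_tail e₆.symm, mul_tail e₅.symm]
  rw [mul_tail c₁.eq, mul_tail c₂.eq, mul_tail c₃.eq]

theorem mul_mul_le {a b : TangleClass} (h : a * b ≤ 1) (x : TangleClass) : a * (b * x) ≤ x := by
  rw [← mul_assoc]
  exact mul_le_of_le_one_left' h

theorem copyKind_flip (k : Kind) (x y : Bool) :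
    copyKind k.flip y x = (copyKind k x y).flip := by
  cases k <;> cases x <;> cases y <;> rfl

theorem copyCross_bigon_le (j : ℕ) (k : Kind) (c d : Copy) :
    copyCross j k c d * copyCross j k.flip d c ≤ 1 := by
  rw [copyCross, copyCross, copyKind_flip]
  exact bigon_le _ _ _ _

theorem grid_mul_grid_le (o : Sense) (j : ℕ) (k : Kind) (s t : Dir) :
    grid o j k s t * grid o j k.flip t s ≤ 1 := by
  have key : ∀ {a b c d a' b' c' d' : TangleClass}, a * a' ≤ 1 → b * b' ≤ 1 → c * c' ≤ 1 →
      d * d' ≤ 1 → c * b' = b' * c → a * (b * (c * (d * (d' * (b' * (c' * a')))))) ≤ 1 := by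
    intro a b c d a' b' c' d' ha hb hc hd e
    calc a * (b * (c * (d * (d' * (b' * (c' * a')))))) ≤ a * (b * (c * (b' * (c' * a')))) := by
          gcongr a * (b * (c * ?_))
          exact mul_mul_le hd _
      _ = a * (b * (b' * (c * (c' * a')))) := by rw [mul_tail e]
      _ ≤ a * (b * (b' * a')) := by
          gcongr a * (b * (b' * ?_))
          exact mul_mul_le hc _
      _ ≤ a * a' := by
          gcongr a * ?_
          exact mul_mul_le hb _
      _ ≤ 1 := ha
  simp only [grid, column, mul_assoc]
  exact key (copyCross_bigon_le _ _ _ _) (copyCross_bigon_le _ _ _ _) (copyCross_bigon_le _ _ _ _)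
    (copyCross_bigon_le _ _ _ _) (copyCross_comm (by omega) ..).symm

theorem doubleCross_bigon_le (o : Sense) (i : ℕ) (k : Kind) (s t : Dir) :
    mk (doubleCross o i k s t) * mk (doubleCross o i k.flip t s) ≤ 1 := by
  rw [mk_doubleCross, mk_doubleCross']
  generalize 2 * i = j
  have hU : underTwist o k s t j (j + 2) * underTwist o k.flip t s (j + 2) j ≤ 1 := by
    cases k
    · have e : isPositive Kind.under t s = !isPositive Kind.over s t := by
        cases s <;> cases t <;> rfl
      simp only [underTwist, Kind.flip, e]
      exact twist_mul_twist_le _ _ _ _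
    · have e : isPositive Kind.over t s = !isPositive Kind.under s t := by
        cases s <;> cases t <;> rfl
      simp only [underTwist, Kind.flip, e]
      exact twist_mul_twist_le _ _ _ _
    · simp [underTwist, Kind.flip]
  calc underTwist o k s t j (j + 2) * grid o j k s t *
        (grid o j k.flip t s * underTwist o k.flip t s (j + 2) j)
      = underTwist o k s t j (j + 2) * (grid o j k s t *
        (grid o j k.flip t s * underTwist o k.flip t s (j + 2) j)) := mul_assoc ..
    _ ≤ underTwist o k s t j (j + 2) * underTwist o k.flip t s (j + 2) j := by
        gcongr
        exact mul_mul_le (grid_mul_grid_le _ _ _ _ _) _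
    _ ≤ 1 := hU

/-! ### Doubled minima and maxima -/

/-- The two copies of a maximum. -/
def doubleCap (o : Sense) (j : ℕ) (s : Dir) : TangleClass :=
  cap (j + 1) (o.right s) * cap j (o.left s)

/-- The two copies of a minimum. -/
def doubleCup (o : Sense) (j : ℕ) (s : Dir) : TangleClass :=
  cup j (o.left s) * cup (j + 1) (o.right s)

end TangleClass

/-- The copy after it has turned at a minimum or maximum: its vertical direction is reversed. -/
def Copy.turn (c : Copy) : Copy := ⟨c.dir.rev, c.main⟩

theorem turn_leftCopy (o : Sense) (s : Dir) : (o.leftCopy s).turn = o.rightCopy s.rev := by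
  cases o <;> cases s <;> rfl

theorem turn_rightCopy (o : Sense) (s : Dir) : (o.rightCopy s).turn = o.leftCopy s.rev := by
  cases o <;> cases s <;> rfl

theorem isPositive_turn_left (k : Kind) (hk : k ≠ .virt) (s t : Dir) :
    isPositive k.flip s.rev t = isPositive k t s := by
  cases k <;> cases s <;> cases t <;> first | rfl | exact absurd rfl hk

theorem isPositive_turn_right (k : Kind) (hk : k ≠ .virt) (s t : Dir) :
    isPositive k.flip t s.rev = isPositive k s t := by
  cases k <;> cases s <;> cases t <;> first | rfl | exact absurd rfl hk

namespace TangleClass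

theorem copyCross_cap (j : ℕ) (k : Kind) (c p : Copy) :
    copyCross j k c p * cap (j + 1) c.dir = copyCross (j + 1) k.flip p c.turn * cap j c.dir := by
  rw [copyCross, slideCap, ← copyKind_flip]
  rfl

theorem cup_copyCross (j : ℕ) (k : Kind) (c p : Copy) :
    cup (j + 1) c.dir * copyCross j k p c = cup j c.dir * copyCross (j + 1) k.flip c.turn p := by
  rw [copyCross, slideCup, ← copyKind_flip]
  rfl

theorem row_cap (j : ℕ) (k : Kind) (c p q : Copy) :
    row j k c p q * cap (j + 2) c.dir = column (j + 1) k.flip p q c.turn * cap j c.dir := by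
  rw [row, mul_assoc, copyCross_cap, ← mul_assoc, copyCross_comm (le_refl (j + 2)), mul_assoc,
    copyCross_cap, column, mul_assoc]

theorem cup_column (j : ℕ) (k : Kind) (c p q : Copy) :
    cup (j + 2) c.dir * column j k p q c = cup j c.dir * row (j + 1) k.flip c.turn p q := by
  rw [column, mul_tail (cup_copyCross ..), ← copyCross_comm (by omega), mul_tail (cup_copyCross ..),
    row]

theorem grid_doubleCap (o : Sense) (j : ℕ) (k : Kind) (s t : Dir) :
    grid o j k s t * doubleCap o (j + 2) s = grid o (j + 2) k.flip t s.rev * doubleCap o j s := by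
  have e₁ : row (j + 1) k (o.rightCopy s) (o.leftCopy t) (o.rightCopy t) *
      cap (j + 3) (o.right s) = _ := row_cap ..
  have e₂ : row j k (o.leftCopy s) (o.leftCopy t) (o.rightCopy t) *
      cap (j + 2) (o.left s) = _ := row_cap ..
  rw [grid_eq_rows, doubleCap, mul_assoc, mul_tail (row_mul_cap (by omega) ..), e₂, mul_tail e₁,
    turn_leftCopy, turn_rightCopy]
  rw [show (o.rightCopy s).dir = o.right s from rfl, mul_tail (cap_mul_column (by omega) ..), grid,
    mul_assoc]
  rfl

theorem doubleCup_grid (o : Sense) (j : ℕ) (k : Kind) (s t : Dir) :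
    doubleCup o (j + 2) s * grid o j k t s = doubleCup o j s * grid o (j + 2) k.flip s.rev t := by
  have e₁ : cup (j + 2) (o.left s) * column j k (o.leftCopy t) (o.rightCopy t) (o.leftCopy s) = _ :=
    cup_column ..
  have e₂ : cup (j + 3) (o.right s) *
      column (j + 1) k (o.leftCopy t) (o.rightCopy t) (o.rightCopy s) = _ := cup_column ..
  rw [grid, doubleCup, mul_assoc, mul_tail (cup_mul_column (by omega) ..), e₂, mul_tail e₁,
    turn_leftCopy, turn_rightCopy]
  rw [show (o.rightCopy s).dir = o.right s from rfl, mul_tail (row_mul_cup (by omega) ..),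
    grid_eq_rows, doubleCup, mul_assoc]
  rfl

/-- A twist slides around a doubled maximum; the order of its crossings is reversed. -/
theorem copyTwist_doubleCap (o : Sense) (j : ℕ) (κ κ' : Kind) (s : Dir) :
    copyTwist o j κ κ' s * doubleCap o j s = copyTwist o (j + 2) κ' κ s.rev * doubleCap o j s := by
  -- a crossing of two copies that turn at nested maxima may be moved to the other end of the maxima
  have key : ∀ (k : Kind) (c d : Copy), copyCross j k c d * (cap (j + 1) c.dir * cap j d.dir) =
      copyCross (j + 2) k c.turn d.turn * (cap (j + 1) d.dir * cap j c.dir) := by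
    intro k c d
    have e := copyCross_cap (j + 1) k.flip d c.turn
    rw [mul_tail (copyCross_cap ..), cap_cap le_rfl, mul_tail e, Kind.flip_flip]
  have e₁ := key κ' (o.rightCopy s) (o.leftCopy s)
  have e₂ := key κ (o.leftCopy s) (o.rightCopy s)
  rw [turn_leftCopy, turn_rightCopy] at e₁ e₂
  simp only [copyTwist, doubleCap, mul_assoc]
  simp only [Sense.leftCopy, Sense.rightCopy] at e₁ e₂ ⊢
  rw [e₁, mul_tail (copyCross_comm le_rfl ..), e₂]

/-- A twist slides around a doubled minimum. -/
theorem doubleCup_copyTwist (o : Sense) (j : ℕ) (κ κ' : Kind) (s : Dir) :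
    doubleCup o j s * copyTwist o j κ κ' s = doubleCup o j s * copyTwist o (j + 2) κ' κ s.rev := by
  -- a crossing of two copies that turn at nested minima may be moved to the other end of the minima
  have key : ∀ (k : Kind) (c d : Copy), cup j c.dir * (cup (j + 1) d.dir * copyCross j k c d) =
      cup j d.dir * (cup (j + 1) c.dir * copyCross (j + 2) k c.turn d.turn) := by
    intro k c d
    have e := cup_copyCross (j + 1) k.flip c d.turn
    rw [cup_copyCross, mul_tail (cup_cup le_rfl d.dir c.dir).symm, e, Kind.flip_flip]
  have e₁ := key κ' (o.rightCopy s) (o.leftCopy s)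
  have e₂ := key κ (o.leftCopy s) (o.rightCopy s)
  rw [turn_leftCopy, turn_rightCopy] at e₁ e₂
  simp only [copyTwist, doubleCup, mul_assoc]
  simp only [Sense.leftCopy, Sense.rightCopy] at e₁ e₂ ⊢
  rw [mul_tail₃ e₂, ← copyCross_comm le_rfl, mul_tail₃ e₁]

theorem twist_doubleCap (o : Sense) (j : ℕ) (pos : Bool) (s : Dir) :
    mk (twist o j pos s) * doubleCap o j s = mk (twist o (j + 2) pos s.rev) * doubleCap o j s := by
  cases pos <;> cases s
  · exact copyTwist_doubleCap o j .virt .over .up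
  · exact copyTwist_doubleCap o j .over .virt .down
  · exact copyTwist_doubleCap o j .under .virt .up
  · exact copyTwist_doubleCap o j .virt .under .down

theorem doubleCup_twist (o : Sense) (j : ℕ) (pos : Bool) (s : Dir) :
    doubleCup o j s * mk (twist o j pos s) = doubleCup o j s * mk (twist o (j + 2) pos s.rev) := by
  cases pos <;> cases s
  · exact doubleCup_copyTwist o j .virt .over .up
  · exact doubleCup_copyTwist o j .over .virt .down
  · exact doubleCup_copyTwist o j .under .virt .up
  · exact doubleCup_copyTwist o j .virt .under .down

theorem twist_mul_doubleCap {i j : ℕ} (h : i + 2 ≤ j) (o : Sense) (pos : Bool) (s t : Dir) :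
    mk (twist o i pos s) * doubleCap o j t = doubleCap o j t * mk (twist o i pos s) := by
  obtain ⟨κ, κ', e⟩ := exists_mk_twist o pos s
  rw [e]
  simp only [copyTwist, doubleCap, mul_assoc]
  rw [mul_tail (copyCross_mul_cap (by omega) ..), copyCross_mul_cap (by omega),
    mul_tail (copyCross_mul_cap (by omega) ..), mul_tail (copyCross_mul_cap (by omega) ..)]

theorem doubleCap_mul_twist {i j : ℕ} (h : i ≤ j) (o : Sense) (pos : Bool) (s t : Dir) :
    doubleCap o i t * mk (twist o j pos s) = mk (twist o (j + 4) pos s) * doubleCap o i t := by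
  obtain ⟨κ, κ', e⟩ := exists_mk_twist o pos s
  rw [e, e]
  simp only [copyTwist, doubleCap, mul_assoc]
  rw [mul_tail (cap_mul_copyCross (by omega) ..), cap_mul_copyCross (by omega),
    mul_tail (cap_mul_copyCross (by omega) ..), mul_tail (cap_mul_copyCross (by omega) ..)]

theorem doubleCup_mul_twist {i j : ℕ} (h : i + 2 ≤ j) (o : Sense) (pos : Bool) (s t : Dir) :
    doubleCup o j t * mk (twist o i pos s) = mk (twist o i pos s) * doubleCup o j t := by
  obtain ⟨κ, κ', e⟩ := exists_mk_twist o pos s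
  rw [e]
  simp only [copyTwist, doubleCup, mul_assoc]
  rw [mul_tail (cup_mul_copyCross (by omega) ..), cup_mul_copyCross (by omega),
    mul_tail (cup_mul_copyCross (by omega) ..), mul_tail (cup_mul_copyCross (by omega) ..)]

theorem twist_mul_doubleCup {i j : ℕ} (h : i ≤ j) (o : Sense) (pos : Bool) (s t : Dir) :
    mk (twist o j pos s) * doubleCup o i t = doubleCup o i t * mk (twist o (j + 4) pos s) := by
  obtain ⟨κ, κ', e⟩ := exists_mk_twist o pos s
  rw [e, e]
  simp only [copyTwist, doubleCup, mul_assoc]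
  rw [mul_tail (copyCross_mul_cup (by omega) ..), copyCross_mul_cup (by omega),
    mul_tail (copyCross_mul_cup (by omega) ..), mul_tail (copyCross_mul_cup (by omega) ..)]

theorem doubleCross_slideCap (o : Sense) (i : ℕ) (k : Kind) (s t : Dir) :
    mk (doubleCross o i k s t) * doubleCap o (2 * (i + 1)) s =
      mk (doubleCross o (i + 1) k.flip t s.rev) * doubleCap o (2 * i) s := by
  cases k
  · -- the twist lies on the strand of direction `t`
    rw [mk_doubleCross, mk_doubleCross, mul_assoc, mul_assoc, mul_add, mul_one, grid_doubleCap]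
    have := isPositive_turn_right .over (by decide) s t
    simp only [Kind.flip] at this
    simp only [underTwist, Kind.flip, this]
  · -- the twist lies on the strand that turns at the maximum, and has to slide around it
    rw [mk_doubleCross, mk_doubleCross', mul_assoc, mul_assoc, mul_add, mul_one, grid_doubleCap]
    have := isPositive_turn_right .under (by decide) s t
    simp only [Kind.flip] at this
    simp only [underTwist, Kind.flip, this]
    rw [← twist_doubleCap, mul_tail (twist_grid_far (by omega) ..)]
  · rw [mk_doubleCross, mk_doubleCross, mul_assoc, mul_assoc, mul_add, mul_one, grid_doubleCap]
    rfl

theorem doubleCross_slideCup (o : Sense) (i : ℕ) (k : Kind) (s t : Dir) :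
    doubleCup o (2 * (i + 1)) s * mk (doubleCross o i k t s) =
      doubleCup o (2 * i) s * mk (doubleCross o (i + 1) k.flip s.rev t) := by
  cases k
  · -- the twist lies on the strand that turns at the minimum, and has to slide around it
    rw [mk_doubleCross', mk_doubleCross, mul_add, mul_one, ← mul_assoc, doubleCup_grid]
    have := isPositive_turn_left .over (by decide) s t
    simp only [Kind.flip] at this
    simp only [underTwist, Kind.flip, this]
    rw [mul_tail (doubleCup_twist ..).symm, twist_grid_far (by omega), mul_assoc]
  · rw [mk_doubleCross', mk_doubleCross', mul_add, mul_one, ← mul_assoc, doubleCup_grid]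
    have := isPositive_turn_left .under (by decide) s t
    simp only [Kind.flip] at this
    simp only [underTwist, Kind.flip, this, mul_assoc]
  · rw [mk_doubleCross', mk_doubleCross', mul_add, mul_one, ← mul_assoc, doubleCup_grid, mul_assoc]
    rfl

theorem doubleZigzagRight_le (o : Sense) (j : ℕ) (s : Dir) :
    doubleCup o (j + 2) s.rev * doubleCap o j s ≤ 1 := by
  have h₁ : cup (j + 2) (o.left s.rev) * cap (j + 1) (o.right s) ≤ 1 := by
    rw [left_rev]
    exact zigzagRight_le _ _
  have h₂ : cup (j + 1) (o.right s.rev) * cap j (o.left s) ≤ 1 := by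
    rw [right_rev]
    exact zigzagRight_le _ _
  calc doubleCup o (j + 2) s.rev * doubleCap o j s
      = cup (j + 2) (o.left s.rev) * (cap (j + 1) (o.right s) *
          (cup (j + 1) (o.right s.rev) * cap j (o.left s))) := by
        rw [doubleCup, doubleCap, mul_assoc, mul_tail (cap_cup le_rfl ..)]
    _ ≤ cup (j + 1) (o.right s.rev) * cap j (o.left s) := mul_mul_le h₁ _
    _ ≤ 1 := h₂

theorem doubleZigzagLeft_le (o : Sense) (j : ℕ) (s : Dir) :
    doubleCup o j s * doubleCap o (j + 2) s.rev ≤ 1 := by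
  have h₁ : cup (j + 1) (o.right s) * cap (j + 2) (o.left s.rev) ≤ 1 := by
    rw [left_rev]
    exact zigzagLeft_le _ _
  have h₂ : cup j (o.left s) * cap (j + 1) (o.right s.rev) ≤ 1 := by
    rw [right_rev]
    exact zigzagLeft_le _ _
  calc doubleCup o j s * doubleCap o (j + 2) s.rev
      = cup j (o.left s) * (cap (j + 1) (o.right s.rev) *
          (cup (j + 1) (o.right s) * cap (j + 2) (o.left s.rev))) := by
        rw [doubleCup, doubleCap, mul_assoc, mul_tail (cup_cap le_rfl ..)]
    _ ≤ cup j (o.left s) * (cap (j + 1) (o.right s.rev) * 1) := by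
        gcongr
    _ ≤ 1 := by rwa [mul_one]

/-! ### Doubled curls -/

/-- The triangle formed by the copies of a strand that crosses itself. -/
theorem triangle_self {x y : Bool} (h : x ≠ y) (k : Kind) :
    Triangle (copyKind k x y) (copyKind k x x) (copyKind k y x) := by
  revert h
  cases x <;> cases y <;> cases k <;> decide

/-- Without the twist, a doubled curl on the right reduces to two crossings of the two copies. -/
theorem doubleCup_grid_doubleCap_right_le (o : Sense) (j : ℕ) (k : Kind) (s : Dir) :
    doubleCup o (j + 2) s * (grid o j k s s * doubleCap o (j + 2) s) ≤ copyTwist o j k k s := by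
  have ht := triangle j (triangle_self (leftIsMain_ne s) k) (o.left s) (o.right s) (o.left s)
  simp only [doubleCup, doubleCap, copyTwist, grid, column, mul_assoc]
  generalize ha : o.leftCopy s = a
  generalize hb : o.rightCopy s = b
  replace ht : copyCross j k a b * (copyCross (j + 1) k a a * copyCross j k b a) =
      copyCross (j + 1) k b a * (copyCross j k a a * copyCross (j + 1) k a b) := by
    rw [← ha, ← hb]
    exact ht
  rw [show o.left s = a.dir from ha ▸ rfl, show o.right s = b.dir from hb ▸ rfl]
  have h₁ : cup (j + 3) b.dir * (copyCross (j + 2) k b b * cap (j + 3) b.dir) ≤ 1 :=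
    curlRight_le _ _ _
  have h₂ : cup (j + 2) a.dir * (copyCross (j + 1) k a a * cap (j + 2) a.dir) ≤ 1 :=
    curlRight_le _ _ _
  calc cup (j + 2) a.dir * (cup (j + 3) b.dir * (copyCross (j + 1) k b a * (copyCross j k a a *
        (copyCross (j + 2) k b b * (copyCross (j + 1) k a b *
          (cap (j + 3) b.dir * cap (j + 2) a.dir))))))
      = cup (j + 2) a.dir * (copyCross (j + 1) k b a * (copyCross j k a a *
        ((cup (j + 3) b.dir * (copyCross (j + 2) k b b * cap (j + 3) b.dir)) *
          (copyCross (j + 1) k a b * cap (j + 2) a.dir)))) := by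
        rw [mul_tail (cup_mul_copyCross (show j + 1 + 2 ≤ j + 3 from le_rfl) ..),
          mul_tail (cup_mul_copyCross (show j + 2 ≤ j + 3 by omega) ..),
          mul_tail (copyCross_mul_cap (show j + 1 + 2 ≤ j + 3 from le_rfl) ..)]
        simp only [mul_assoc]
    _ ≤ cup (j + 2) a.dir * (copyCross (j + 1) k b a * (copyCross j k a a *
        (1 * (copyCross (j + 1) k a b * cap (j + 2) a.dir)))) := by gcongr
    _ = copyCross j k a b * ((cup (j + 2) a.dir * (copyCross (j + 1) k a a * cap (j + 2) a.dir)) *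
        copyCross j k b a) := by
        rw [one_mul, mul_tail₃ ht.symm, copyCross_mul_cap (by omega),
          mul_tail (cup_mul_copyCross (by omega) ..)]
        simp only [mul_assoc]
    _ ≤ copyCross j k a b * (1 * copyCross j k b a) := by gcongr
    _ = copyCross j k a b * copyCross j k b a := by rw [one_mul]

/-- Without the twist, a doubled curl on the left reduces to two crossings of the two copies. -/
theorem doubleCup_grid_doubleCap_left_le (o : Sense) (j : ℕ) (k : Kind) (s : Dir) :
    doubleCup o j s.rev * (grid o (j + 2) k s s * doubleCap o j s.rev) ≤ copyTwist o j k k s := by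
  have ht := triangle (j + 1) (triangle_self (leftIsMain_ne s).symm k) (o.right s) (o.left s)
    (o.right s)
  simp only [doubleCup, doubleCap, copyTwist, grid, column, mul_assoc, left_rev, right_rev]
  generalize ha : o.leftCopy s = a
  generalize hb : o.rightCopy s = b
  replace ht : copyCross (j + 1) k b a * (copyCross (j + 2) k b b * copyCross (j + 1) k a b) =
      copyCross (j + 2) k a b * (copyCross (j + 1) k b b * copyCross (j + 2) k b a) := by
    rw [← ha, ← hb]
    exact ht
  rw [show o.left s = a.dir from ha ▸ rfl, show o.right s = b.dir from hb ▸ rfl]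
  have h₁ : cup (j + 1) a.dir.rev * (copyCross (j + 2) k a a * cap (j + 1) a.dir.rev) ≤ 1 :=
    curlLeft_le _ _ _
  have h₂ : cup j b.dir.rev * (copyCross (j + 1) k b b * cap j b.dir.rev) ≤ 1 :=
    curlLeft_le _ _ _
  calc cup j b.dir.rev * (cup (j + 1) a.dir.rev * (copyCross (j + 3) k b a *
        (copyCross (j + 2) k a a * (copyCross (j + 4) k b b * (copyCross (j + 3) k a b *
          (cap (j + 1) a.dir.rev * cap j b.dir.rev))))))
      = cup j b.dir.rev * (copyCross (j + 1) k b a *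
        ((cup (j + 1) a.dir.rev * (copyCross (j + 2) k a a * cap (j + 1) a.dir.rev)) *
          (copyCross (j + 2) k b b * (copyCross (j + 1) k a b * cap j b.dir.rev)))) := by
        simp only [mul_assoc]
        rw [mul_tail (copyCross_mul_cup (le_refl (j + 1)) ..).symm,
          mul_tail (cap_mul_copyCross (show j + 1 ≤ j + 2 by omega) ..),
          mul_tail (cap_mul_copyCross (le_refl (j + 1)) ..)]
    _ ≤ cup j b.dir.rev * (copyCross (j + 1) k b a *
        (1 * (copyCross (j + 2) k b b * (copyCross (j + 1) k a b * cap j b.dir.rev)))) := by gcongr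
    _ = copyCross j k a b * ((cup j b.dir.rev * (copyCross (j + 1) k b b * cap j b.dir.rev)) *
        copyCross j k b a) := by
        rw [one_mul, mul_tail₃ ht, mul_tail (copyCross_mul_cup (le_refl j) ..).symm]
        simp only [mul_assoc]
        rw [cap_mul_copyCross (le_refl j)]
    _ ≤ copyCross j k a b * (1 * copyCross j k b a) := by gcongr
    _ = copyCross j k a b * copyCross j k b a := by rw [one_mul]

/-- The twist belonging to a curl cancels the crossings of the two copies with each other that the
doubled curl leaves behind. -/
theorem copyTwist_mul_twist_le (o : Sense) (j : ℕ) (k : Kind) (hk : k ≠ .virt) (s : Dir) :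
    copyTwist o j k k s * mk (twist o j (isPositive k s s) s) ≤ 1 ∧
      mk (twist o j (isPositive k s s) s) * copyTwist o j k k s ≤ 1 := by
  have key : ∀ κ κ' κ₁ κ₁' : Kind, κ₁ = κ'.flip → κ₁' = κ.flip → ∀ a b : Dir,
      (cross j κ a b * cross j κ' b a) * (cross j κ₁ a b * cross j κ₁' b a) ≤ 1 := by
    rintro κ κ' _ _ rfl rfl a b
    rw [mul_assoc]
    exact bigon_bigon_le j κ κ' a b
  cases k
  · cases s <;> exact ⟨key _ _ _ _ rfl rfl _ _, key _ _ _ _ rfl rfl _ _⟩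
  · cases s <;> exact ⟨key _ _ _ _ rfl rfl _ _, key _ _ _ _ rfl rfl _ _⟩
  · exact absurd rfl hk

/-- A doubled curl on the right disappears.  The twist is placed on the end of the under strand that
does not lead into the loop, so that it commutes with the minima and maxima. -/
theorem doubleCurlRight_le (o : Sense) (i : ℕ) (k : Kind) (s : Dir) :
    doubleCup o (2 * (i + 1)) s * (mk (doubleCross o i k s s) * doubleCap o (2 * (i + 1)) s) ≤ 1 := by
  rw [mul_add, mul_one]
  cases k
  · rw [mk_doubleCross', underTwist, mul_assoc, twist_mul_doubleCap le_rfl]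
    simp only [← mul_assoc]
    rw [mul_assoc (doubleCup _ _ _)]
    exact (mul_le_mul_left (doubleCup_grid_doubleCap_right_le o _ _ s) _).trans
      (copyTwist_mul_twist_le o _ .over (by decide) s).1
  · rw [mk_doubleCross, underTwist, mul_assoc, mul_tail (doubleCup_mul_twist le_rfl ..)]
    exact (mul_le_mul_right (doubleCup_grid_doubleCap_right_le o _ _ s) _).trans
      (copyTwist_mul_twist_le o _ .under (by decide) s).2
  · rw [mk_doubleCross, underTwist, one_mul]
    exact (doubleCup_grid_doubleCap_right_le o _ _ s).trans (bigon_le _ .virt _ _)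

/-- The mirror image of `doubleCurlRight_le`. -/
theorem doubleCurlLeft_le (o : Sense) (i : ℕ) (k : Kind) (s : Dir) :
    doubleCup o (2 * i) s.rev * (mk (doubleCross o (i + 1) k s s) * doubleCap o (2 * i) s.rev) ≤
      1 := by
  cases k
  · rw [mk_doubleCross, underTwist, mul_add, mul_one, mul_assoc,
      mul_tail (twist_mul_doubleCup le_rfl ..).symm]
    exact (mul_le_mul_right (doubleCup_grid_doubleCap_left_le o _ _ s) _).trans
      (copyTwist_mul_twist_le o _ .over (by decide) s).2
  · rw [mk_doubleCross', underTwist, mul_add, mul_one, mul_assoc,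
      (doubleCap_mul_twist le_rfl ..).symm]
    simp only [← mul_assoc]
    rw [mul_assoc (doubleCup _ _ _)]
    exact (mul_le_mul_left (doubleCup_grid_doubleCap_left_le o _ _ s) _).trans
      (copyTwist_mul_twist_le o _ .under (by decide) s).1
  · rw [mk_doubleCross, underTwist, one_mul]
    exact (doubleCup_grid_doubleCap_left_le o _ _ s).trans (bigon_le _ .virt _ _)

end TangleClass

/-! ### Pieces beside each other -/

/-- The word with `i` more strands to the left. -/
def shift (i : ℕ) (w : List Layer) : List Layer := w.map fun x => ⟨i + x.pos, x.piece⟩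

namespace TangleClass

theorem layer_mul_shift (p : Piece) (i m n : ℕ) (h : i + p.top.length ≤ m)
    (h' : m + p.bot.length = n + p.top.length) (y : List Layer) :
    mk [⟨i, p⟩] * mk (shift m y) = mk (shift n y) * mk [⟨i, p⟩] := by
  induction y with
  | nil => rfl
  | cons x y ih =>
    obtain ⟨j, q⟩ := x
    have e := exchange i (m - (i + p.top.length) + j) p q
    rw [show i + p.top.length + (m - (i + p.top.length) + j) = m + j by omega,
      show i + p.bot.length + (m - (i + p.top.length) + j) = n + j by omega] at e
    change mk _ * mk (_ :: shift m y) = mk (_ :: shift n y) * mk _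
    rw [mk_cons _ (shift m y), mk_cons _ (shift n y), mul_tail e, ih, mul_assoc]

/-- Two words beside each other exchange heights; only the widths of the first one matter. -/
theorem shift_mul_shift {x : List Layer} {a b : List Dir} (hx : Fits x a b) (i n : ℕ)
    (y : List Layer) :
    mk (shift i x) * mk (shift (i + b.length + n) y) =
      mk (shift (i + a.length + n) y) * mk (shift i x) := by
  induction x generalizing a with
  | nil =>
    obtain rfl : a = b := hx
    change 1 * _ = _ * 1
    rw [one_mul, mul_one]
  | cons z x ih =>
    obtain ⟨c, hz, hw⟩ := hx
    obtain ⟨l, r, hl, rfl, rfl⟩ := hz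
    have e := layer_mul_shift z.piece (i + z.pos) (i + (l ++ z.piece.top ++ r).length + n)
      (i + (l ++ z.piece.bot ++ r).length + n) (by simp; omega) (by simp; omega) y
    change mk (_ :: shift i x) * _ = _ * mk (_ :: shift i x)
    rw [mk_cons _ (shift i x), mul_assoc, ih hw, mul_tail e]

theorem doubleLayer_eq_shift (o : Sense) (i : ℕ) (p : Piece) :
    doubleLayer o ⟨i, p⟩ = shift (2 * i) (doubleLayer o ⟨0, p⟩) := by
  have hg : ∀ k s t, WeldedLinks.grid o i k s t = shift (2 * i) (WeldedLinks.grid o 0 k s t) :=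
    fun _ _ _ => rfl
  have ht : ∀ j pos s, twist o (2 * i + j) pos s = shift (2 * i) (twist o j pos s) := by
    intro j pos s
    cases pos <;> cases s <;> rfl
  have ha : ∀ u v, shift (2 * i) (u ++ v) = shift (2 * i) u ++ shift (2 * i) v :=
    fun _ _ => List.map_append
  cases p with
  | cup s => rfl
  | cap s => rfl
  | cross k s t =>
    cases k
    · simp only [doubleLayer, doubleCross]
      split <;> simp only [ha, hg, ← ht, mul_zero, add_zero, zero_add]
    · simp only [doubleLayer, doubleCross]
      split <;> simp only [ha, hg, ← ht, mul_zero, add_zero, zero_add]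
    · exact hg ..

theorem doubleLayer_exchange (o : Sense) (i n : ℕ) (p q : Piece) :
    mk (doubleLayer o ⟨i, p⟩) * mk (doubleLayer o ⟨i + p.top.length + n, q⟩) =
      mk (doubleLayer o ⟨i + p.bot.length + n, q⟩) * mk (doubleLayer o ⟨i, p⟩) := by
  have h : Fits (doubleLayer o ⟨0, p⟩) (doubleLevel o p.bot) (doubleLevel o p.top) :=
    fits_doubleLayer o ⟨[], [], rfl, by simp, by simp⟩
  have e := shift_mul_shift h (2 * i) (2 * n) (doubleLayer o ⟨0, q⟩)
  rw [length_doubleLevel, length_doubleLevel] at e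
  simp only [doubleLayer_eq_shift o i p, doubleLayer_eq_shift o (_ + n) q, mul_add]
  exact e

/-- Every local move remains valid after doubling. -/
theorem mk_flatMap_le (o : Sense) {x y : List Layer} (h : Move x y) :
    mk (x.flatMap (doubleLayer o)) ≤ mk (y.flatMap (doubleLayer o)) := by
  have hc : ∀ (p : Layer) w, mk ((p :: w).flatMap (doubleLayer o)) =
      mk (doubleLayer o p) * mk (w.flatMap (doubleLayer o)) := fun p w => by
    rw [List.flatMap_cons, mk_append]
  cases h <;> simp only [hc, List.flatMap_nil, mk_nil, mul_one]
  case exchange i n p q => exact (doubleLayer_exchange o i n p q).le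
  case zigzagRight i s => exact doubleZigzagRight_le o (2 * i) s
  case zigzagLeft i s => exact doubleZigzagLeft_le o (2 * i) s
  case slideCap i k s t => exact (doubleCross_slideCap o i k s t).le
  case slideCup i k s t => exact (doubleCross_slideCup o i k s t).le
  case curlRight i k s => exact doubleCurlRight_le o i k s
  case curlLeft i k s => exact doubleCurlLeft_le o i k s
  case bigon i k s t => exact doubleCross_bigon_le o i k s t
  case triangle i k₁₂ k₁₃ k₂₃ h s t u => exact (doubleCross_triangle o i h s t u).le

end TangleClass

/-! ### Doubling of welded links -/

theorem Diagram.double_step (o : Sense) {D D' : Diagram} (h : D.Step D') :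
    WeldedEquiv (D.double o) (D'.double o) := by
  obtain ⟨w, hw⟩ := D
  obtain ⟨w', hw'⟩ := D'
  obtain ⟨u, x, y, v, hm, rfl, rfl⟩ := h
  have hd := fits_double o hw
  have e : ∀ z : List Layer, (u ++ z ++ v).flatMap (doubleLayer o) = u.flatMap (doubleLayer o) ++
      z.flatMap (doubleLayer o) ++ v.flatMap (doubleLayer o) := fun z => by
    rw [List.flatMap_append, List.flatMap_append]
  rw [e] at hd
  obtain ⟨_, h₁⟩ := TangleClass.mk_le_mk.1 (TangleClass.mk_flatMap_le o hm) _ _ hd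
  unfold Diagram.double
  simp only [e]
  exact h₁

theorem WeldedEquiv.double (o : Sense) {D D' : Diagram} (h : WeldedEquiv D D') :
    WeldedEquiv (D.double o) (D'.double o) := by
  induction h with
  | rel _ _ h => exact Diagram.double_step o h
  | refl _ => exact .refl _
  | symm _ _ _ ih => exact ih.symm
  | trans _ _ _ _ _ ih ih' => exact ih.trans _ _ _ ih'

theorem existsUnique_weldedLink_map (o : Sense) :
    ∃! f : WeldedLink → WeldedLink, ∀ D : Diagram, f D.toWeldedLink = (D.double o).toWeldedLink := by
  refine ⟨Quotient.map (Diagram.double o) fun _ _ h => WeldedEquiv.double o h, fun _ => rfl, ?_⟩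
  intro f hf
  funext L
  induction L using Quotient.inductionOn
  exact hf _

end WeldedLinks

theorem theorem2p1 :
    (∀ D D' : WeldedLinks.Diagram, WeldedLinks.WeldedEquiv D D' →
      WeldedLinks.WeldedEquiv (WeldedLinks.phiPlus D) (WeldedLinks.phiPlus D') ∧
      WeldedLinks.WeldedEquiv (WeldedLinks.phiMinus D) (WeldedLinks.phiMinus D')) ∧
    (∃! f : WeldedLinks.WeldedLink → WeldedLinks.WeldedLink,
      ∀ D : WeldedLinks.Diagram, f D.toWeldedLink = (WeldedLinks.phiPlus D).toWeldedLink) ∧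
    (∃! f : WeldedLinks.WeldedLink → WeldedLinks.WeldedLink,
      ∀ D : WeldedLinks.Diagram, f D.toWeldedLink = (WeldedLinks.phiMinus D).toWeldedLink) :=
  ⟨fun _ _ h => ⟨h.double .parallel, h.double .antiparallel⟩,
    WeldedLinks.existsUnique_weldedLink_map .parallel,
    WeldedLinks.existsUnique_weldedLink_map .antiparallel⟩
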